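/- **Setting.** For a commutative ring $R$ let $\mathrm{Sp}_{2n}(R)=\{g\in R^{2n\times 2n} : {}^tgJg=J\}$ with $J=\begin{pmatrix}0_n&-1_n\\1_n&0_n\end{pmatrix}$, and let $\Gamma_0^{(n)}(N)=\{\begin{pmatrix}A&B\\C&D\end{pmatrix}\in \mathrm{Sp}_{2n}(\mathbf Z): C\equiv 0 \bmod N\}$. Let $\mathfrak H_r$ be the Siegel upper half space of degree $r$ ($\mathfrak H_0$ is a point). For $0\le r\le n$ and $Z\in\mathfrak H_r$ let $j_{r,n}(Z)$ be the column span of $\begin{pmatrix}1_n\\ \mathrm{diag}(Z^{-1},0)\end{pmatrix}$, a point of the Grassmannian of $n$-dimensional subspaces of $\mathbf C^{2n}$, and put $\mathfrak H_n^*=\bigcup_{r=0}^n \mathrm{Sp}_{2n}(\mathbf Q)\,j_{r,n}(\mathfrak H_r)$. For a subgroup $\Gamma$ of $\mathrm{Sp}_{2n}(\mathbf Q)$ (such as a congruence subgroup) the Satake compactification of $\Gamma\backslash\mathfrak H_n$ is, as a set, $\Gamma\backslash\mathfrak H_n^*$. Let $\xi_{r,n}:\mathrm{Sp}_{2r}\to\mathrm{Sp}_{2n}$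 be the embedding $$\begin{pmatrix}A&B\\C&D\end{pmatrix}\mapsto\begin{pmatrix}A&0&B&0\\0&1_{n-r}&0&0\\C&0&D&0\\0&0&0&1_{n-r}\end{pmatrix},$$ let $P_{n,r}\subset \mathrm{Sp}_{2n}$ be the parabolic subgroup of matrices of the form $$p=\begin{pmatrix}A_{11}&0&B_{11}&B_{12}\\A_{21}&A_{22}&B_{21}&B_{22}\\C_{11}&0&D_{11}&D_{12}\\0&0&0&D_{22}\end{pmatrix}\quad(*_{11}\text{ of size } r),$$ and let $\omega_{n,r}:P_{n,r}\to\mathrm{Sp}_{2r}$, $p\mapsto\begin{pmatrix}A_{11}&B_{11}\\C_{11}&D_{11}\end{pmatrix}$. For $\gamma\in\mathrm{Sp}_{2n}(\mathbf Q)$ put $\Gamma_\gamma^{(r)}=\omega_{n,r}(\gamma^{-1}\Gamma\gamma\cap P_{n,r}(\mathbf Q))$. There is a well-defined map $$\Gamma_\gamma^{(r)}\backslash\mathfrak H_r^*\to\Gamma\backslash\mathfrak H_n^*,\qquad \Gamma_\gamma^{(r)}\rho\, j_{s,r}(Z)\mapsto\Gamma\gamma\,\xi_{r,n}(\rho)\,j_{s,n}(Z)\quad(0\le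 s\le r,\ \rho\in\mathrm{Sp}_{2r}(\mathbf Q),\ Z\in\mathfrak H_s).\tag{1}$$ Its image is called the $r$-cusp of $\Gamma\backslash\mathfrak H_n^*$ associated to $\gamma$. **Theorem.** Let $n\ge1$ and let $N$ be a squarefree positive integer. For $1\le m\le n$ and $l\mid N$ fix any $\gamma^{(m)}(l)\in\mathrm{Sp}_{2m}(\mathbf Z)$ with $\gamma^{(m)}(l)\equiv\begin{pmatrix}0_m&-1_m\\1_m&0_m\end{pmatrix}\bmod l^2$ and $\gamma^{(m)}(l)\equiv 1_{2m}\bmod (N/l)^2$. For $0\le r\le n$ and pairwise coprime positive divisors $l_{n-r},\dots,l_1$ of $N$ put $$\gamma_r^{(n)}(l_{n-r},\dots,l_1)=\gamma^{(n)}(l_{n-r})\,\xi_{n-1,n}(\gamma^{(n-1)}(l_{n-r-1}))\cdots\xi_{r+1,n}(\gamma^{(r+1)}(l_1)).$$ 0. For each $0\le r\le n$, assigning to $(l_{n-r},\dots,l_1)$ the $r$-cusp of $\Gamma_0^{(n)}(N)\backslash\mathfrak H_n^*$ associated to $\gamma_r^{(n)}(l_{n-r},\dots,l_1)$ is a bijection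 from the set of all tuples of pairwise coprime positive divisors of $N$ of length $n-r$ onto the set of $r$-cusps. (Below an $r$-cusp is identified with its tuple.) 1. Let $0\le s\le r\le n$, let $(l_{n-r},\dots,l_1)$ be an $r$-cusp, $\gamma=\gamma_r^{(n)}(l_{n-r},\dots,l_1)$ and $\Gamma=\Gamma_0^{(n)}(N)$. If two $s$-cusps of $\Gamma_\gamma^{(r)}\backslash\mathfrak H_r^*$ have the same image in $\Gamma_0^{(n)}(N)\backslash\mathfrak H_n^*$ under (1), then they are equal. In other words, no $r$-cusp intersects itself at an $s$-cusp. 2. Let $0\le s<n-1$ and let $(l_{n-s},\dots,l_1)$ be an $s$-cusp. The $(s+1)$-cusps containing it are precisely the cusps $$\left(l_{n-s}c_{n-s-1},\ \frac{l_{n-s-1}}{c_{n-s-1}}c_{n-s-2},\ \frac{l_{n-s-2}}{c_{n-s-2}}c_{n-s-3},\ \dots,\ \frac{l_2}{c_2}c_1\right),$$ where $c_i\mid l_i$ for $1\le i\le n-s-1$ (each such tuple again consists of pairwise coprime positive divisors of $N$). -/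

import Mathlib

open Matrix

set_option linter.unusedSectionVars false

namespace SiegelCusps

/-- The symplectic group `Sp_{2n}(R)`, with respect to `J = (0 -1; 1 0)`. -/
abbrev Sp (n : ℕ) (R : Type*) [CommRing R] : Type _ := ↥(symplecticGroup (Fin n) R)

/-- Extension of scalars `Sp_{2n}(R) → Sp_{2n}(S)`. -/
def Sp.map {R S : Type*} [CommRing R] [CommRing S] (n : ℕ) (f : R →+* S) : Sp n R →* Sp n S where
  toFun g := ⟨g.1.map f, SymplecticGroup.map_mem g.2 f⟩
  map_one' := Subtype.ext (Matrix.map_one f (map_zero f) (map_one f))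
  map_mul' _ _ := Subtype.ext Matrix.map_mul

section Blocks

variable {r n : ℕ} {R : Type*} [CommRing R]

/-- The splitting of `n` indices into the first `r` and the last `n - r`. -/
def split (h : r ≤ n) : Fin r ⊕ Fin (n - r) ≃ Fin n :=
  finSumFinEquiv.trans (finCongr (by omega))

/-- An `n × n` matrix cut into blocks of sizes `r` and `n - r`. -/
def blk (h : r ≤ n) (M : Matrix (Fin n) (Fin n) R) :
    Matrix (Fin r ⊕ Fin (n - r)) (Fin r ⊕ Fin (n - r)) R :=
  M.submatrix (split h) (split h)

/-- The `n × n` block diagonal matrix `diag(M, D)` with `M` of size `r`. -/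
def pad (h : r ≤ n) (M : Matrix (Fin r) (Fin r) R) (D : Matrix (Fin (n - r)) (Fin (n - r)) R) :
    Matrix (Fin n) (Fin n) R :=
  (fromBlocks M 0 0 D).submatrix (split h).symm (split h).symm

theorem pad_mul (h : r ≤ n) (M M' : Matrix (Fin r) (Fin r) R)
    (D D' : Matrix (Fin (n - r)) (Fin (n - r)) R) :
    pad h M D * pad h M' D' = pad h (M * M') (D * D') := by
  simp [pad, submatrix_mul_equiv, fromBlocks_multiply]

theorem pad_sub (h : r ≤ n) (M M' : Matrix (Fin r) (Fin r) R)
    (D D' : Matrix (Fin (n - r)) (Fin (n - r)) R) :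
    pad h M D - pad h M' D' = pad h (M - M') (D - D') := by
  rw [sub_eq_add_neg, sub_eq_add_neg, sub_eq_add_neg]
  change (fromBlocks M 0 0 D + -fromBlocks M' 0 0 D').submatrix (split h).symm (split h).symm = _
  simp [pad, fromBlocks_neg, fromBlocks_add]

theorem pad_transpose (h : r ≤ n) (M : Matrix (Fin r) (Fin r) R)
    (D : Matrix (Fin (n - r)) (Fin (n - r)) R) :
    (pad h M D)ᵀ = pad h Mᵀ Dᵀ := by
  simp [pad, fromBlocks_transpose]

theorem pad_one (h : r ≤ n) :
    pad h (1 : Matrix (Fin r) (Fin r) R) (1 : Matrix (Fin (n - r)) (Fin (n - r)) R) = 1 := by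
  simp [pad, fromBlocks_one]

theorem blk_pad (h : r ≤ n) (M : Matrix (Fin r) (Fin r) R)
    (D : Matrix (Fin (n - r)) (Fin (n - r)) R) : blk h (pad h M D) = fromBlocks M 0 0 D := by
  simp [blk, pad]

theorem blk_mul (h : r ≤ n) (M M' : Matrix (Fin n) (Fin n) R) :
    blk h (M * M') = blk h M * blk h M' := by
  simp [blk, submatrix_mul_equiv]

theorem blk_transpose (h : r ≤ n) (M : Matrix (Fin n) (Fin n) R) :
    blk h Mᵀ = (blk h M)ᵀ := rfl

theorem blk_add (h : r ≤ n) (M M' : Matrix (Fin n) (Fin n) R) :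
    blk h (M + M') = blk h M + blk h M' := rfl

theorem blk_one (h : r ≤ n) : blk h (1 : Matrix (Fin n) (Fin n) R) = 1 := by
  simp [blk]

/-- The embedding `ξ_{r,n} : Sp_{2r} → Sp_{2n}`. -/
def xi (h : r ≤ n) (g : Sp r R) : Sp n R :=
  ⟨fromBlocks (pad h g.1.toBlocks₁₁ 1) (pad h g.1.toBlocks₁₂ 0)
      (pad h g.1.toBlocks₂₁ 0) (pad h g.1.toBlocks₂₂ 1), by
    have hg := g.2
    rw [← fromBlocks_toBlocks g.1, SymplecticGroup.fromBlocks_mem_iff] at hg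
    obtain ⟨h1, h2, h3⟩ := hg
    rw [SymplecticGroup.fromBlocks_mem_iff]
    simp only [pad_transpose, pad_mul, pad_sub, h1, h2, h3]
    refine ⟨by simp, by simp, ?_⟩
    simp [pad_one]⟩

theorem toBlocks_mul (a b : Matrix (Fin n ⊕ Fin n) (Fin n ⊕ Fin n) R) :
    a * b = fromBlocks (a.toBlocks₁₁ * b.toBlocks₁₁ + a.toBlocks₁₂ * b.toBlocks₂₁)
      (a.toBlocks₁₁ * b.toBlocks₁₂ + a.toBlocks₁₂ * b.toBlocks₂₂)
      (a.toBlocks₂₁ * b.toBlocks₁₁ + a.toBlocks₂₂ * b.toBlocks₂₁)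
      (a.toBlocks₂₁ * b.toBlocks₁₂ + a.toBlocks₂₂ * b.toBlocks₂₂) := by
  conv_lhs => rw [← fromBlocks_toBlocks a, ← fromBlocks_toBlocks b, fromBlocks_multiply]

theorem inv_blocks (g : Sp n R) :
    (g⁻¹).1 =
      fromBlocks g.1.toBlocks₂₂ᵀ (-g.1.toBlocks₁₂ᵀ)
        (-g.1.toBlocks₂₁ᵀ) g.1.toBlocks₁₁ᵀ := by
  rw [SymplecticGroup.coe_inv]
  conv_lhs => rw [← fromBlocks_toBlocks g.1]
  simp [J, fromBlocks_transpose, fromBlocks_neg, fromBlocks_multiply]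

/-- The parabolic subgroup `P_{n,r}` of `Sp_{2n}`: the matrices with blocks
`A = (A₁₁ 0; A₂₁ A₂₂)`, `B` arbitrary, `C = (C₁₁ 0; 0 0)`, `D = (D₁₁ D₁₂; 0 D₂₂)`. -/
def parabolic (R : Type*) [CommRing R] (h : r ≤ n) : Subgroup (Sp n R) where
  carrier := {g | (blk h g.1.toBlocks₁₁).toBlocks₁₂ = 0 ∧
    blk h g.1.toBlocks₂₁ =
      fromBlocks (blk h g.1.toBlocks₂₁).toBlocks₁₁ 0 0 0 ∧
    (blk h g.1.toBlocks₂₂).toBlocks₂₁ = 0}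
  one_mem' := by
    refine ⟨?_, ?_, ?_⟩
    · simp [← fromBlocks_one, blk_one, toBlocks_fromBlocks₁₂]
    · rw [show (1 : Sp n R).1.toBlocks₂₁ = 0 by
        simp [← fromBlocks_one]]
      ext (i | i) (j | j) <;> simp [blk, toBlocks₁₁]
    · simp [← fromBlocks_one, blk_one]
  mul_mem' := by
    rintro a b ⟨ha1, ha2, ha3⟩ ⟨hb1, hb2, hb3⟩
    have ea := (fromBlocks_toBlocks (blk h a.1.toBlocks₁₁)).symm
    have eb := (fromBlocks_toBlocks (blk h b.1.toBlocks₁₁)).symm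
    have ea' := (fromBlocks_toBlocks (blk h a.1.toBlocks₂₂)).symm
    have eb' := (fromBlocks_toBlocks (blk h b.1.toBlocks₂₂)).symm
    have fa := (fromBlocks_toBlocks (blk h a.1.toBlocks₁₂)).symm
    have fb := (fromBlocks_toBlocks (blk h b.1.toBlocks₁₂)).symm
    rw [ha1] at ea
    rw [hb1] at eb
    rw [ha3] at ea'
    rw [hb3] at eb'
    simp only [Set.mem_ofPred_eq, Submonoid.coe_mul]
    rw [toBlocks_mul]
    simp only [toBlocks_fromBlocks₁₁, toBlocks_fromBlocks₂₁, toBlocks_fromBlocks₂₂, blk_add,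
      blk_mul]
    rw [ea, eb, ea', eb', ha2, hb2, fa, fb]
    simp [fromBlocks_multiply, fromBlocks_add]
  inv_mem' := by
    rintro a ⟨ha1, ha2, ha3⟩
    simp only [Set.mem_ofPred_eq]
    rw [inv_blocks]
    simp only [toBlocks_fromBlocks₁₁, toBlocks_fromBlocks₂₁, toBlocks_fromBlocks₂₂]
    refine ⟨?_, ?_, ?_⟩
    · rw [blk_transpose]
      exact congrArg transpose ha3
    · change -(blk h a.1.toBlocks₂₁)ᵀ = fromBlocks (-(blk h a.1.toBlocks₂₁)ᵀ).toBlocks₁₁ 0 0 0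
      rw [ha2]
      simp [fromBlocks_transpose, fromBlocks_neg]
    · rw [blk_transpose]
      exact congrArg transpose ha1

/-- The surjection `ω_{n,r} : P_{n,r} → Sp_{2r}`, `p ↦ (A₁₁ B₁₁; C₁₁ D₁₁)`. -/
def omega (R : Type*) [CommRing R] (h : r ≤ n) : parabolic R h →* Sp r R where
  toFun p := ⟨fromBlocks (blk h p.1.1.toBlocks₁₁).toBlocks₁₁
      (blk h p.1.1.toBlocks₁₂).toBlocks₁₁
      (blk h p.1.1.toBlocks₂₁).toBlocks₁₁
      (blk h p.1.1.toBlocks₂₂).toBlocks₁₁, by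
    obtain ⟨⟨a, ha⟩, h1, h2, h3⟩ := p
    simp only at h1 h2 h3 ⊢
    rw [← fromBlocks_toBlocks a, SymplecticGroup.fromBlocks_mem_iff] at ha
    obtain ⟨k1, k2, k3⟩ := ha
    have e1 := (fromBlocks_toBlocks (blk h a.toBlocks₁₁)).symm
    have e2 := (fromBlocks_toBlocks (blk h a.toBlocks₂₂)).symm
    have e3 := (fromBlocks_toBlocks (blk h a.toBlocks₁₂)).symm
    rw [h1] at e1
    rw [h3] at e2
    have k1' := congrArg (blk h) k1
    have k2' := congrArg (blk h) k2
    have k3' := congrArg (blk h) (sub_eq_iff_eq_add.1 k3)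
    simp only [blk_mul, blk_transpose, blk_add, blk_one] at k1' k2' k3'
    rw [h2, e1] at k1'
    rw [e2, e3] at k2'
    rw [e1, e2, e3, h2, ← fromBlocks_one] at k3'
    simp only [fromBlocks_transpose, fromBlocks_multiply, fromBlocks_add, fromBlocks_inj,
      transpose_zero, Matrix.zero_mul, Matrix.mul_zero, add_zero, zero_add] at k1' k2' k3'
    rw [SymplecticGroup.fromBlocks_mem_iff]
    exact ⟨k1'.1, k2'.1, sub_eq_iff_eq_add.2 k3'.1⟩⟩
  map_one' := by
    apply Subtype.ext
    simp only [OneMemClass.coe_one]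
    rw [← fromBlocks_one, ← fromBlocks_one]
    simp only [toBlocks_fromBlocks₁₁, toBlocks_fromBlocks₁₂, toBlocks_fromBlocks₂₁,
      toBlocks_fromBlocks₂₂, blk_one]
    rw [← fromBlocks_one]
    simp only [toBlocks_fromBlocks₁₁]
    congr 1
  map_mul' := by
    rintro ⟨⟨a, ha⟩, ha1, ha2, ha3⟩ ⟨⟨b, hb⟩, hb1, hb2, hb3⟩
    apply Subtype.ext
    simp only at ha1 ha2 ha3 hb1 hb2 hb3
    have ea := (fromBlocks_toBlocks (blk h a.toBlocks₁₁)).symm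
    have eb := (fromBlocks_toBlocks (blk h b.toBlocks₁₁)).symm
    have ea' := (fromBlocks_toBlocks (blk h a.toBlocks₂₂)).symm
    have eb' := (fromBlocks_toBlocks (blk h b.toBlocks₂₂)).symm
    have fa := (fromBlocks_toBlocks (blk h a.toBlocks₁₂)).symm
    have fb := (fromBlocks_toBlocks (blk h b.toBlocks₁₂)).symm
    rw [ha1] at ea
    rw [hb1] at eb
    rw [ha3] at ea'
    rw [hb3] at eb'
    change fromBlocks (blk h (a * b).toBlocks₁₁).toBlocks₁₁ (blk h (a * b).toBlocks₁₂).toBlocks₁₁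
      (blk h (a * b).toBlocks₂₁).toBlocks₁₁ (blk h (a * b).toBlocks₂₂).toBlocks₁₁ =
      fromBlocks (blk h a.toBlocks₁₁).toBlocks₁₁ (blk h a.toBlocks₁₂).toBlocks₁₁
        (blk h a.toBlocks₂₁).toBlocks₁₁ (blk h a.toBlocks₂₂).toBlocks₁₁ *
      fromBlocks (blk h b.toBlocks₁₁).toBlocks₁₁ (blk h b.toBlocks₁₂).toBlocks₁₁
        (blk h b.toBlocks₂₁).toBlocks₁₁ (blk h b.toBlocks₂₂).toBlocks₁₁
    rw [toBlocks_mul a b, fromBlocks_multiply]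
    simp only [toBlocks_fromBlocks₁₁, toBlocks_fromBlocks₂₁, toBlocks_fromBlocks₂₂,
      toBlocks_fromBlocks₁₂, blk_add, blk_mul]
    rw [ea, eb, ea', eb', ha2, hb2, fa, fb]
    simp [fromBlocks_multiply, fromBlocks_add]

end Blocks

/-- `Γ₀⁽ⁿ⁾(N)`, as a subgroup of `Sp_{2n}(ℚ)`: the image of
`{(A B; C D) ∈ Sp_{2n}(ℤ) | C ≡ 0 mod N}`. -/
def Gamma0 (n N : ℕ) : Subgroup (Sp n ℚ) :=
  Subgroup.map (Sp.map n (Int.castRingHom ℚ))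
    { carrier := {g : Sp n ℤ | ∀ i j, (N : ℤ) ∣ g.1.toBlocks₂₁ i j}
      one_mem' := fun i j => by simp [toBlocks₂₁]
      mul_mem' := by
        intro a b ha hb i j
        rw [Submonoid.coe_mul, toBlocks_mul, toBlocks_fromBlocks₂₁]
        rw [Matrix.add_apply, mul_apply, mul_apply]
        exact dvd_add (Finset.dvd_sum fun k _ => (ha i k).mul_right _)
          (Finset.dvd_sum fun k _ => (hb k j).mul_left _)
      inv_mem' := by
        intro a ha i j
        rw [inv_blocks, toBlocks_fromBlocks₂₁]
        exact (dvd_neg).2 (ha j i) }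

/-- Siegel's upper half space of degree `n` (a single point for `n = 0`). -/
def UpperHalfSpace (n : ℕ) : Type :=
  {Z : Matrix (Fin n) (Fin n) ℂ // Zᵀ = Z ∧ (Z.map Complex.im).PosDef}

/-- `Sp_{2n}(ℚ)` acting on subspaces of `ℂ²ⁿ` by matrix multiplication on the left. -/
noncomputable def act {n : ℕ} (g : Sp n ℚ) (W : Submodule ℂ (Fin n ⊕ Fin n → ℂ)) :
    Submodule ℂ (Fin n ⊕ Fin n → ℂ) :=
  W.map (g.1.map (algebraMap ℚ ℂ)).mulVecLin

theorem act_one {n : ℕ} (W : Submodule ℂ (Fin n ⊕ Fin n → ℂ)) : act 1 W = W := by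
  simp [act, mulVecLin_one]

theorem act_mul {n : ℕ} (g g' : Sp n ℚ) (W : Submodule ℂ (Fin n ⊕ Fin n → ℂ)) :
    act (g * g') W = act g (act g' W) := by
  simp [act, Matrix.map_mul, mulVecLin_mul, Submodule.map_comp]

/-- The point `j_{r,n}(Z)` of the Grassmannian of `n`-dimensional subspaces of `ℂ²ⁿ`: the column
span of the `2n × n` matrix with upper half `1` and lower half `diag(Z⁻¹, 0)`. -/
noncomputable def jPoint {r n : ℕ} (h : r ≤ n) (Z : UpperHalfSpace r) :
    Submodule ℂ (Fin n ⊕ Fin n → ℂ) :=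
  LinearMap.range (fromRows (1 : Matrix (Fin n) (Fin n) ℂ) (pad h Z.1⁻¹ 0)).mulVecLin

/-- The space `ℌ_n^*`, the union over `0 ≤ r ≤ n` of the orbits `Sp_{2n}(ℚ) j_{r,n}(ℌ_r)`. -/
def HStar (n : ℕ) : Type :=
  {W : Submodule ℂ (Fin n ⊕ Fin n → ℂ) //
    ∃ (r : ℕ) (h : r ≤ n) (γ : Sp n ℚ) (Z : UpperHalfSpace r), W = act γ (jPoint h Z)}

noncomputable instance (n : ℕ) : MulAction (Sp n ℚ) (HStar n) where
  smul g W := ⟨act g W.1, by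
    obtain ⟨W, r, h, γ, Z, rfl⟩ := W
    exact ⟨r, h, g * γ, Z, (act_mul _ _ _).symm⟩⟩
  one_smul W := Subtype.ext (act_one _)
  mul_smul g g' W := Subtype.ext (act_mul _ _ _)

/-- The underlying set `Γ \ ℌ_n^*` of the Satake compactification of `Γ \ ℌ_n`. -/
abbrev Satake {n : ℕ} (Γ : Subgroup (Sp n ℚ)) : Type := MulAction.orbitRel.Quotient Γ (HStar n)

section Boundary

variable {r n : ℕ}

/-- For a subspace `W` of `ℂ²ʳ`, the subspace of `ℂ²ⁿ` spanned by `W` (put in the first `r`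
coordinates of both halves) and the last `n - r` unit vectors of the upper half. -/
def extend (h : r ≤ n) (W : Submodule ℂ (Fin r ⊕ Fin r → ℂ)) :
    Submodule ℂ (Fin n ⊕ Fin n → ℂ) where
  carrier := {v | (v ∘ Sum.map (split h ∘ Sum.inl) (split h ∘ Sum.inl)) ∈ W ∧
    ∀ i, v (Sum.inr (split h (Sum.inr i))) = 0}
  add_mem' := by
    rintro v w ⟨hv, hv'⟩ ⟨hw, hw'⟩
    exact ⟨W.add_mem hv hw, fun i => by simp [hv' i, hw' i]⟩
  zero_mem' := ⟨W.zero_mem, fun _ => rfl⟩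
  smul_mem' := by
    rintro c v ⟨hv, hv'⟩
    exact ⟨W.smul_mem c hv, fun i => by simp [hv' i]⟩

theorem parabolic_entries (h : r ≤ n) {g : Sp n ℚ} (hg : g ∈ parabolic ℚ h) :
    (∀ i j, g.1 (Sum.inl (split h (Sum.inl i))) (Sum.inl (split h (Sum.inr j))) = 0) ∧
    (∀ i j, g.1 (Sum.inr (split h (Sum.inl i))) (Sum.inl (split h (Sum.inr j))) = 0) ∧
    (∀ i j, g.1 (Sum.inr (split h (Sum.inr i))) (Sum.inl (split h j)) = 0) ∧
    (∀ i j, g.1 (Sum.inr (split h (Sum.inr i))) (Sum.inr (split h (Sum.inl j))) = 0) := by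
  obtain ⟨h1, h2, h3⟩ := hg
  refine ⟨fun i j => congrFun (congrFun h1 i) j,
    fun i j => congrFun (congrFun h2 (Sum.inl i)) (Sum.inr j), fun i j => ?_,
    fun i j => congrFun (congrFun h3 i) j⟩
  cases j with
  | inl j => exact congrFun (congrFun h2 (Sum.inr i)) (Sum.inl j)
  | inr j => exact congrFun (congrFun h2 (Sum.inr i)) (Sum.inr j)

theorem mulVec_mem_extend (h : r ≤ n) (p : parabolic ℚ h) (W : Submodule ℂ (Fin r ⊕ Fin r → ℂ))
    {v : Fin n ⊕ Fin n → ℂ} (hv : v ∈ extend h W) :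
    p.1.1.map (algebraMap ℚ ℂ) *ᵥ v ∈ extend h (act (omega ℚ h p) W) := by
  obtain ⟨hv1, hv2⟩ := hv
  obtain ⟨e1, e2, e3, e4⟩ := parabolic_entries h p.2
  refine ⟨⟨_, hv1, ?_⟩, fun i => ?_⟩
  · funext i
    cases i <;>
    simp [mulVec, dotProduct, Fintype.sum_sum_type, ← (split h).sum_comp, e1, e2, hv2, omega, blk,
      toBlocks₁₁, toBlocks₁₂, toBlocks₂₁, toBlocks₂₂]
  · simp [mulVec, dotProduct, Fintype.sum_sum_type, ← (split h).sum_comp, e3, e4, hv2]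

theorem extend_act (h : r ≤ n) (p : parabolic ℚ h) (W : Submodule ℂ (Fin r ⊕ Fin r → ℂ)) :
    extend h (act (omega ℚ h p) W) = act p.1 (extend h W) := by
  apply le_antisymm
  · intro v hv
    have := mulVec_mem_extend h p⁻¹ _ hv
    rw [← act_mul, ← map_mul, inv_mul_cancel, map_one, act_one] at this
    have h2 := Submodule.mem_map_of_mem
      (f := (p.1.1.map (algebraMap ℚ ℂ)).mulVecLin) this
    rw [mulVecLin_apply, mulVec_mulVec, ← Matrix.map_mul] at h2
    have h3 : p.1.1 * (p⁻¹).1.1 = 1 := congrArg Subtype.val (mul_inv_cancel p.1)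
    rw [h3, Matrix.map_one _ (map_zero _) (map_one _), one_mulVec] at h2
    exact h2
  · rintro _ ⟨v, hv, rfl⟩
    exact mulVec_mem_extend h p W hv

theorem xi_mem (h : r ≤ n) (g : Sp r ℚ) : xi h g ∈ parabolic ℚ h := by
  refine ⟨?_, ?_, ?_⟩ <;> simp [xi, blk_pad]

theorem omega_xi (h : r ≤ n) (g : Sp r ℚ) : omega ℚ h ⟨xi h g, xi_mem h g⟩ = g := by
  apply Subtype.ext
  simp [omega, xi, blk_pad, fromBlocks_toBlocks]

theorem mem_jPoint (h : r ≤ n) (Z : UpperHalfSpace r) (v : Fin n ⊕ Fin n → ℂ) :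
    v ∈ jPoint h Z ↔ v ∘ Sum.inr = pad h Z.1⁻¹ 0 *ᵥ (v ∘ Sum.inl) := by
  constructor
  · rintro ⟨w, rfl⟩
    ext i
    simp [fromRows_mulVec, Function.comp_def]
  · intro hv
    refine ⟨v ∘ Sum.inl, ?_⟩
    ext i
    cases i with
    | inl i => simp [fromRows_mulVec]
    | inr i => simpa [fromRows_mulVec] using (congrFun hv i).symm

theorem pad_apply (h : r ≤ n) {R : Type*} [CommRing R] (M : Matrix (Fin r) (Fin r) R)
    (i j : Fin n) :
    pad h M 0 i j = if hij : i.1 < r ∧ j.1 < r then M ⟨i, hij.1⟩ ⟨j, hij.2⟩ else 0 := by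
  obtain ⟨i, rfl⟩ := (split h).surjective i
  obtain ⟨j, rfl⟩ := (split h).surjective j
  simp only [pad, submatrix_apply, Equiv.symm_apply_apply]
  cases i <;> cases j <;> simp [split]

theorem pad_pad {s : ℕ} (hs : s ≤ r) (h : r ≤ n) {R : Type*} [CommRing R]
    (M : Matrix (Fin s) (Fin s) R) : pad h (pad hs M 0) 0 = pad (hs.trans h) M 0 := by
  ext i j
  simp only [pad_apply]
  split_ifs <;> first | rfl | omega

theorem extend_jPoint {s : ℕ} (hs : s ≤ r) (h : r ≤ n) (Z : UpperHalfSpace s) :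
    extend h (jPoint hs Z) = jPoint (hs.trans h) Z := by
  ext v
  rw [mem_jPoint, ← pad_pad hs h]
  change (_ ∈ jPoint hs Z ∧ _) ↔ _
  rw [mem_jPoint, funext_iff, funext_iff, ← (split h).forall_congr_right, Sum.forall]
  simp [pad, mulVec, dotProduct, ← (split h).sum_comp]

/-- `extend` as a map `ℌ_r^* → ℌ_n^*`. It sends `ρ j_{s,r}(Z)` to `ξ_{r,n}(ρ) j_{s,n}(Z)`. -/
noncomputable def HStar.extend (h : r ≤ n) (W : HStar r) : HStar n :=
  ⟨SiegelCusps.extend h W.1, by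
    obtain ⟨W, s, hs, ρ, Z, rfl⟩ := W
    refine ⟨s, hs.trans h, xi h ρ, Z, ?_⟩
    rw [← extend_jPoint hs h, ← extend_act h ⟨xi h ρ, xi_mem h ρ⟩, omega_xi]⟩

/-- The group `Γ_γ⁽ʳ⁾ = ω_{n,r}(γ⁻¹ Γ γ ∩ P_{n,r}(ℚ))`. -/
def boundaryGroup (h : r ≤ n) (Γ : Subgroup (Sp n ℚ)) (γ : Sp n ℚ) : Subgroup (Sp r ℚ) :=
  ((Γ.comap (MulAut.conj γ).toMonoidHom).subgroupOf (parabolic ℚ h)).map (omega ℚ h)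

/-- The map `Γ_γ⁽ʳ⁾ \ ℌ_r^* → Γ \ ℌ_n^*`,
`Γ_γ⁽ʳ⁾ ρ j_{s,r}(Z) ↦ Γ γ ξ_{r,n}(ρ) j_{s,n}(Z)`. -/
noncomputable def boundaryMap (h : r ≤ n) (Γ : Subgroup (Sp n ℚ)) (γ : Sp n ℚ) :
    Satake (boundaryGroup h Γ γ) → Satake Γ :=
  Quotient.map' (fun W => γ • W.extend h) (by
    rintro _ W ⟨⟨_, p, hp, rfl⟩, rfl⟩
    refine ⟨⟨γ * p.1 * γ⁻¹, hp⟩, ?_⟩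
    change (γ * p.1 * γ⁻¹) • γ • W.extend h = γ • _
    rw [smul_smul, inv_mul_cancel_right, mul_smul]
    congr 1
    exact Subtype.ext (extend_act h p W.1).symm)

/-- The `r`-cusp of `Γ \ ℌ_n^*` associated to `γ`: the copy of `Γ_γ⁽ʳ⁾ \ ℌ_r^*` in `Γ \ ℌ_n^*`. -/
def cusp (h : r ≤ n) (Γ : Subgroup (Sp n ℚ)) (γ : Sp n ℚ) : Set (Satake Γ) :=
  Set.range (boundaryMap h Γ γ)

/-- The set of all `r`-cusps of `Γ \ ℌ_n^*`. -/
def cusps (h : r ≤ n) (Γ : Subgroup (Sp n ℚ)) : Set (Set (Satake Γ)) :=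
  Set.range (cusp h Γ)

end Boundary

/-- `g ≡ (0 -1; 1 0) mod l²` and `g ≡ 1 mod (N/l)²`. -/
def IsBasicRep (m N l : ℕ) (g : Sp m ℤ) : Prop :=
  (Sp.map m (Int.castRingHom (ZMod (l ^ 2))) g).1 = J (Fin m) (ZMod (l ^ 2)) ∧
    Sp.map m (Int.castRingHom (ZMod ((N / l) ^ 2))) g = 1

/-- A tuple `(l_k, …, l_1)` of pairwise coprime positive divisors of `N`, where `l_i` is written
`l ⟨i - 1, _⟩`. -/
def IsCuspTuple (N : ℕ) {k : ℕ} (l : Fin k → ℕ) : Prop :=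
  (∀ i, 0 < l i ∧ l i ∣ N) ∧ Pairwise fun i j => Nat.Coprime (l i) (l j)

/-- The product
`ξ_{n,n}(γ⁽ⁿ⁾(l_{n-r})) ξ_{n-1,n}(γ⁽ⁿ⁻¹⁾(l_{n-r-1})) ⋯ ξ_{r+1,n}(γ⁽ʳ⁺¹⁾(l_1))`
(with `ξ_{n,n}` the identity), for given integral matrices `γ⁽ᵐ⁾(l) = g m l`. -/
def cuspRep (g : ∀ m : ℕ, ℕ → Sp m ℤ) {r n : ℕ} (l : Fin (n - r) → ℕ) : Sp n ℚ :=
  (List.ofFn fun i : Fin (n - r) =>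
    xi (show r + (i + 1) ≤ n by omega)
      (Sp.map _ (Int.castRingHom ℚ) (g (r + (i + 1)) (l i)))).reverse.prod

/-- The tuple `(l_k c_{k-1}, (l_{k-1} / c_{k-1}) c_{k-2}, …, (l_2 / c_2) c_1)` of length
`k - 1`, where `k = n - s`. -/
def shiftTuple {n s : ℕ} (l : Fin (n - s) → ℕ) (c : Fin (n - (s + 1)) → ℕ) :
    Fin (n - (s + 1)) → ℕ :=
  fun i => l ⟨i + 1, by omega⟩ / (if h : i + 1 < n - (s + 1) then c ⟨i + 1, h⟩ else 1) * c i

end SiegelCusps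

/-! An `r`-cusp depends only on the double coset of `γ` in `Γ₀(N) \ Sp(ℚ) / P_{n,r}(ℚ)`, and these
double cosets are classified by ranks modulo the primes dividing `N`. By `exists_integral_mul`,
`Sp(ℚ)` is the product of `Sp(ℤ)` and a group lying in all standard parabolics, so integral
representatives suffice. For integral `g` and `p ∣ N`, let `rankAt p g t` be the rank modulo `p` of
the last `n - t` columns of the lower left block of `g`.

Two facts carry the proof. If the `s`-cusp of `a` lies in the `t`-cusp of `b`, then `rankAt p b t ≤
rankAt p a s ≤ rankAt p b t + (t - s)`: a point of the smaller cusp with few rational vectors forces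
an element `a⁻¹ d b`, with `d ∈ Γ₀(N)`, to map one rational isotropic subspace into the other
(`rankAt_of_cusp_subset`). Conversely, if for every `p ∣ N` the ranks of two integral matrices agree
at both `r` and `s`, the matrices differ by `Γ₀(N)` on the left and `P_{n,r} ∩ P_{n,s}` on the right
(`exists_of_rankAt_eq`). Column reduction modulo each `p` brings both to the same Weyl element,
using only unipotent operations, which lift to `ℤ` independently at different primes; since `N` is
squarefree, membership in `Γ₀(N)` is tested modulo these primes.

The tuple of a cusp lists its ranks: `p` divides `l_k` exactly when the rank at `p` is `k`, and no
entry when it is `0`. This gives the bijection. Two `s`-cusps of one `r`-cusp with the same image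
have equal ranks at `r` and at `s`, and applying `ω` to the resulting relation identifies them
(`cusp_eq_of_image_eq`). Finally an `s`-cusp lies in an `(s+1)`-cusp exactly when at every `p` the
rank stays the same or drops by one; `c_k` collects the primes of `l_k` whose rank stays. -/

namespace SiegelCusps

/-! ### Parabolic subgroups as stabilizers of coordinate subspaces -/

section Parabolic

variable {r n : ℕ} {R : Type*} [CommRing R]

theorem split_inl_val (h : r ≤ n) (i : Fin r) : (split h (Sum.inl i) : ℕ) = i := by
  simp [split]

theorem split_inr_val (h : r ≤ n) (i : Fin (n - r)) : (split h (Sum.inr i) : ℕ) = r + i := by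
  simp [split]

theorem exists_split_inl (h : r ≤ n) {i : Fin n} (hi : (i : ℕ) < r) :
    ∃ k, i = split h (Sum.inl k) :=
  ⟨⟨i, hi⟩, Fin.ext (split_inl_val h ⟨i, hi⟩).symm⟩

theorem exists_split_inr (h : r ≤ n) {i : Fin n} (hi : r ≤ (i : ℕ)) :
    ∃ k, i = split h (Sum.inr k) :=
  ⟨⟨i - r, by omega⟩, Fin.ext (by rw [split_inr_val]; simp; omega)⟩

/-- The matrix `g` maps the span of the upper unit vectors of index `≥ t` into the span of the
upper unit vectors of index `≥ r`. -/
def ColSupp (t r : ℕ) (g : Matrix (Fin n ⊕ Fin n) (Fin n ⊕ Fin n) R) : Prop :=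
  ∀ j : Fin n, t ≤ j → ∀ i : Fin n,
    g (Sum.inr i) (Sum.inl j) = 0 ∧ ((i : ℕ) < r → g (Sum.inl i) (Sum.inl j) = 0)

theorem eq_zero_of_isUnit_mul {m k : ℕ} {M : Matrix (Fin m) (Fin m) R} (hM : IsUnit M)
    {X : Matrix (Fin m) (Fin k) R} (h : M * X = 0) : X = 0 := by
  rw [← Matrix.one_mul X, ← nonsing_inv_mul M ((isUnit_iff_isUnit_det M).1 hM), Matrix.mul_assoc, h,
    Matrix.mul_zero]

/-- Stabilizing the span of the upper unit vectors of index `≥ r` already forces the other vanishing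
conditions: the symplectic relations give `ᵗA₂₂ D₂₂ = 1`, `ᵗA₂₂ C₂₁ = 0` and `ᵗA₂₂ D₂₁ = 0`. -/
theorem mem_parabolic_iff (h : r ≤ n) (g : Sp n R) : g ∈ parabolic R h ↔ ColSupp r r g.1 := by
  constructor
  · rintro ⟨h1, h2, -⟩ j hj i
    obtain ⟨j, rfl⟩ := exists_split_inr h hj
    constructor
    · obtain ⟨i, rfl⟩ := (split h).surjective i
      cases i with
      | inl i => exact congrFun (congrFun h2 (Sum.inl i)) (Sum.inr j)
      | inr i => exact congrFun (congrFun h2 (Sum.inr i)) (Sum.inr j)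
    · intro hi
      obtain ⟨i, rfl⟩ := exists_split_inl h hi
      exact congrFun (congrFun h1 i) j
  · obtain ⟨a, ha⟩ := g
    intro hg
    have h1 : (blk h a.toBlocks₁₁).toBlocks₁₂ = 0 := by
      ext i j
      exact (hg _ (by rw [split_inr_val]; omega) _).2 (by rw [split_inl_val]; omega)
    have h2 : (blk h a.toBlocks₂₁).toBlocks₁₂ = 0 := by
      ext i j
      exact (hg _ (by rw [split_inr_val]; omega) _).1
    have h3 : (blk h a.toBlocks₂₁).toBlocks₂₂ = 0 := by
      ext i j
      exact (hg _ (by rw [split_inr_val]; omega) _).1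
    have ha' := ha
    rw [← fromBlocks_toBlocks a, SymplecticGroup.fromBlocks_mem_iff] at ha
    obtain ⟨k1, -, k3⟩ := ha
    have e1 := (fromBlocks_toBlocks (blk h a.toBlocks₁₁)).symm
    have e2 := (fromBlocks_toBlocks (blk h a.toBlocks₂₂)).symm
    have e3 := (fromBlocks_toBlocks (blk h a.toBlocks₁₂)).symm
    have e4 := (fromBlocks_toBlocks (blk h a.toBlocks₂₁)).symm
    rw [h1] at e1
    rw [h2, h3] at e4
    have k1' := congrArg (blk h) k1
    have k3' := congrArg (blk h) (sub_eq_iff_eq_add.1 k3)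
    simp only [blk_mul, blk_transpose, blk_add, blk_one] at k1' k3'
    rw [e1, e4] at k1'
    rw [e1, e2, e3, e4, ← fromBlocks_one] at k3'
    simp only [fromBlocks_transpose, fromBlocks_multiply, fromBlocks_add, fromBlocks_inj,
      transpose_zero, Matrix.zero_mul, Matrix.mul_zero, add_zero, zero_add] at k1' k3'
    have hu : IsUnit (blk h a.toBlocks₁₁).toBlocks₂₂ᵀ :=
      (isUnit_iff_isUnit_det _).2 (isUnit_det_of_right_inverse k3'.2.2.2)
    refine ⟨h1, ?_, eq_zero_of_isUnit_mul hu k3'.2.2.1⟩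
    have h4 : (blk h a.toBlocks₂₁).toBlocks₂₁ = 0 := eq_zero_of_isUnit_mul hu k1'.2.2.1
    simp only
    conv_lhs => rw [e4, h4]

/-- The lower rows of index `≥ r` of an element of `P_{n,r}`. -/
theorem parabolic_lower (h : r ≤ n) {g : Sp n R} (hg : g ∈ parabolic R h) {i : Fin n}
    (hi : r ≤ i) (j : Fin n) :
    g.1 (Sum.inr i) (Sum.inl j) = 0 ∧ ((j : ℕ) < r → g.1 (Sum.inr i) (Sum.inr j) = 0) := by
  obtain ⟨-, h2, h3⟩ := hg
  obtain ⟨i, rfl⟩ := exists_split_inr h hi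
  constructor
  · obtain ⟨j, rfl⟩ := (split h).surjective j
    cases j with
    | inl j => exact congrFun (congrFun h2 (Sum.inr i)) (Sum.inl j)
    | inr j => exact congrFun (congrFun h2 (Sum.inr i)) (Sum.inr j)
  · intro hj
    obtain ⟨j, rfl⟩ := exists_split_inl h hj
    exact congrFun (congrFun h3 i) j

/-- The Siegel parabolic subgroup, of matrices with vanishing lower left block. -/
abbrev siegel (n : ℕ) (R : Type*) [CommRing R] : Subgroup (Sp n R) := parabolic R (Nat.zero_le n)

theorem mem_siegel_iff (g : Sp n R) : g ∈ siegel n R ↔ g.1.toBlocks₂₁ = 0 := by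
  rw [mem_parabolic_iff]
  constructor
  · intro h
    ext i j
    exact (h j (Nat.zero_le _) i).1
  · intro h j _ i
    exact ⟨congrFun (congrFun h i) j, fun hi => absurd hi (Nat.not_lt_zero _)⟩

theorem Sp.map_apply {S : Type*} [CommRing S] (f : R →+* S) (g : Sp n R) (i j : Fin n ⊕ Fin n) :
    (Sp.map n f g).1 i j = f (g.1 i j) := rfl

theorem Sp.map_injective {S : Type*} [CommRing S] {f : R →+* S} (hf : Function.Injective f) :
    Function.Injective (Sp.map n f) := fun a b h => by
  apply Subtype.ext
  ext i j
  exact hf (congrFun (congrFun (congrArg Subtype.val h) i) j)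

theorem ColSupp.map {t r : ℕ} {S : Type*} [CommRing S] (f : R →+* S) {g : Sp n R}
    (hg : ColSupp t r g.1) : ColSupp t r (Sp.map n f g).1 := fun j hj i =>
  ⟨by rw [Sp.map_apply, (hg j hj i).1, map_zero],
    fun hi => by rw [Sp.map_apply, (hg j hj i).2 hi, map_zero]⟩

theorem ColSupp.of_map {t r : ℕ} {S : Type*} [CommRing S] {f : R →+* S}
    (hf : Function.Injective f) {g : Sp n R} (hg : ColSupp t r (Sp.map n f g).1) :
    ColSupp t r g.1 := fun j hj i =>
  ⟨hf (by rw [map_zero, ← Sp.map_apply, (hg j hj i).1]),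
    fun hi => hf (by rw [map_zero, ← Sp.map_apply, (hg j hj i).2 hi])⟩

theorem map_mem_parabolic (h : r ≤ n) {S : Type*} [CommRing S] (f : R →+* S) {g : Sp n R}
    (hg : g ∈ parabolic R h) : Sp.map n f g ∈ parabolic S h :=
  (mem_parabolic_iff h _).2 (((mem_parabolic_iff h g).1 hg).map f)

end Parabolic

/-! ### Unipotent, Levi and Weyl elements -/

section Elements

variable {n : ℕ} {R : Type*} [CommRing R]

/-- The element `(1 S; 0 1)`. -/
def upper (S : Matrix (Fin n) (Fin n) R) (hS : Sᵀ = S) : Sp n R :=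
  ⟨fromBlocks 1 S 0 1, by rw [SymplecticGroup.fromBlocks_mem_iff]; simp [hS]⟩

/-- The element `(1 0; S 1)`. -/
def lower (S : Matrix (Fin n) (Fin n) R) (hS : Sᵀ = S) : Sp n R :=
  ⟨fromBlocks 1 0 S 1, by rw [SymplecticGroup.fromBlocks_mem_iff]; simp [hS]⟩

/-- The element `(A 0; 0 ᵗA⁻¹)`. -/
def levi (A A' : Matrix (Fin n) (Fin n) R) (h : A' * A = 1) : Sp n R :=
  ⟨fromBlocks A 0 0 A'ᵀ, by
    rw [SymplecticGroup.fromBlocks_mem_iff]; simp [← transpose_mul, h]⟩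

/-- The indicator matrix `diag(1_I)`. -/
def ind (R : Type*) [CommRing R] (I : Finset (Fin n)) : Matrix (Fin n) (Fin n) R :=
  diagonal fun i => if i ∈ I then 1 else 0

theorem ind_transpose (I : Finset (Fin n)) : (ind R I)ᵀ = ind R I := diagonal_transpose _

theorem ind_mul_ind (I : Finset (Fin n)) : ind R I * ind R I = ind R I := by
  rw [ind, diagonal_mul_diagonal]
  congr 1
  ext i
  split_ifs <;> simp

theorem ind_mulVec (I : Finset (Fin n)) (v : Fin n → R) (i : Fin n) :
    (ind R I *ᵥ v) i = if i ∈ I then v i else 0 := by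
  simp [ind, mulVec_diagonal]

theorem mul_ind_apply (I : Finset (Fin n)) (C : Matrix (Fin n) (Fin n) R) (i j : Fin n) :
    (C * ind R I) i j = if j ∈ I then C i j else 0 := by
  simp [ind]

/-- The Weyl element acting as `(0 -1; 1 0)` on the coordinates in `I` and trivially on the
others. -/
def weyl (R : Type*) [CommRing R] (I : Finset (Fin n)) : Sp n R :=
  ⟨fromBlocks (1 - ind R I) (-ind R I) (ind R I) (1 - ind R I), by
    rw [SymplecticGroup.fromBlocks_mem_iff]
    have := ind_mul_ind (R := R) I
    simp only [transpose_sub, transpose_one, ind_transpose, transpose_neg]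
    refine ⟨by noncomm_ring, by noncomm_ring, ?_⟩
    have h1 : (1 - ind R I) * (1 - ind R I) = 1 - ind R I := by
      rw [mul_sub, sub_mul, sub_mul, this]; simp
    rw [h1, mul_neg, this]; simp⟩

/-- Reduces questions about Weyl elements (membership in a subgroup, lifting to `ℤ`) to unipotent
elements. -/
theorem weyl_inv (I : Finset (Fin n)) : (weyl R I)⁻¹ =
    upper (ind R I) (ind_transpose I) * lower (-ind R I) (by rw [transpose_neg, ind_transpose]) *
      upper (ind R I) (ind_transpose I) := by
  apply Subtype.ext
  rw [inv_blocks]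
  change _ = fromBlocks _ _ _ _ * fromBlocks _ _ _ _ * fromBlocks _ _ _ _
  have := ind_mul_ind (R := R) I
  have h2 : (1 + -ind R I) * ind R I = 0 := by rw [add_mul, neg_mul, this]; simp
  simp only [weyl, toBlocks_fromBlocks₁₁, toBlocks_fromBlocks₁₂, toBlocks_fromBlocks₂₁,
    toBlocks_fromBlocks₂₂, fromBlocks_multiply, transpose_sub, transpose_one, ind_transpose,
    transpose_neg, mul_one, one_mul, mul_zero, add_zero, zero_add, mul_neg, neg_mul,
    this, neg_neg]
  congr 1
  · abel
  · rw [← sub_eq_add_neg, sub_mul, this]; simp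
  · abel

theorem weyl_union {I K : Finset (Fin n)} (h : Disjoint I K) :
    weyl R (I ∪ K) = weyl R I * weyl R K := by
  have h0 : ind R I * ind R K = 0 := by
    rw [ind, ind, diagonal_mul_diagonal, ← diagonal_zero]
    congr 1
    ext i
    by_cases hi : i ∈ I
    · simp [Finset.disjoint_left.1 h hi]
    · simp [hi]
  have h1 : ind R (I ∪ K) = ind R I + ind R K := by
    rw [ind, ind, ind, diagonal_add]
    congr 1
    ext i
    by_cases hi : i ∈ I
    · simp [hi, Finset.disjoint_left.1 h hi]
    · simp [hi]
  apply Subtype.ext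
  change fromBlocks _ _ _ _ = fromBlocks _ _ _ _ * fromBlocks _ _ _ _
  rw [fromBlocks_multiply, h1]
  simp only [sub_mul, mul_sub, one_mul, mul_one, h0, neg_mul, mul_neg]
  congr 1 <;> abel

theorem mul_toBlocks₂₁ (a b : Sp n R) : (a * b).1.toBlocks₂₁ =
    a.1.toBlocks₂₁ * b.1.toBlocks₁₁ + a.1.toBlocks₂₂ * b.1.toBlocks₂₁ := by
  rw [Submonoid.coe_mul, toBlocks_mul, toBlocks_fromBlocks₂₁]

theorem mul_toBlocks₂₂ (a b : Sp n R) : (a * b).1.toBlocks₂₂ =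
    a.1.toBlocks₂₁ * b.1.toBlocks₁₂ + a.1.toBlocks₂₂ * b.1.toBlocks₂₂ := by
  rw [Submonoid.coe_mul, toBlocks_mul, toBlocks_fromBlocks₂₂]

theorem toBlocks₂₁_comm (g : Sp n R) :
    g.1.toBlocks₂₁ * g.1.toBlocks₂₂ᵀ = g.1.toBlocks₂₂ * g.1.toBlocks₂₁ᵀ := by
  have h := (g⁻¹).2
  rw [inv_blocks, SymplecticGroup.fromBlocks_mem_iff] at h
  simpa using h.1.symm

/-- If the lower left block `C` of `g` is supported on the columns in `I`, and these columns are
linearly independent, then `g` is in the double coset of the Weyl element of `I`. -/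
theorem exists_upper_weyl (g : Sp n R) (I : Finset (Fin n))
    (h1 : g.1.toBlocks₂₁ * ind R I = g.1.toBlocks₂₁)
    (H : Matrix (Fin n) (Fin n) R) (h2 : H * g.1.toBlocks₂₁ = ind R I) :
    ∃ (S : Matrix (Fin n) (Fin n) R) (hS : Sᵀ = S),
      g * upper S hS * (weyl R I)⁻¹ ∈ siegel n R := by
  set C := g.1.toBlocks₂₁ with hC
  set D := g.1.toBlocks₂₂ with hD
  set e := ind R I with he
  have heT : eᵀ = e := ind_transpose I
  have hCD : C * Dᵀ = D * Cᵀ := toBlocks₂₁_comm g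
  have hCH : Cᵀ * Hᵀ = e := by rw [← transpose_mul, h2, heT]
  have hS : (H * D * e)ᵀ = H * D * e := by
    rw [transpose_mul, transpose_mul, heT, ← Matrix.mul_assoc]
    calc e * Dᵀ * Hᵀ = H * (C * Dᵀ) * Hᵀ := by rw [← Matrix.mul_assoc H, h2]
      _ = H * D * (Cᵀ * Hᵀ) := by rw [hCD]; simp only [Matrix.mul_assoc]
      _ = _ := by rw [hCH]
  -- Multiplication by `upper S` replaces `D` by `C * S + D`. This `S` kills the columns of that
  -- block in `I`, which are the ones that the Weyl element moves into the lower left block.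
  refine ⟨-(H * D * e), by rw [transpose_neg, hS], ?_⟩
  have h3 : C * (H * D * e) = D * e := by
    rw [← hS, transpose_mul, transpose_mul, heT]
    calc C * (e * (Dᵀ * Hᵀ)) = C * Dᵀ * Hᵀ := by
          rw [← Matrix.mul_assoc, h1, Matrix.mul_assoc]
      _ = D * (Cᵀ * Hᵀ) := by rw [hCD, Matrix.mul_assoc]
      _ = _ := by rw [hCH]
  rw [mem_siegel_iff, mul_toBlocks₂₁, mul_toBlocks₂₁, mul_toBlocks₂₂, inv_blocks]
  simp only [upper, weyl, toBlocks_fromBlocks₁₁, toBlocks_fromBlocks₁₂, toBlocks_fromBlocks₂₁,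
    toBlocks_fromBlocks₂₂, transpose_sub, transpose_one, ← hC, ← hD, ← he, heT]
  simp only [mul_sub, mul_one, mul_zero, add_zero, h1, sub_self, zero_add, mul_neg, add_mul, h3,
    neg_mul]
  rw [Matrix.mul_assoc D e e, ind_mul_ind, ← he, neg_add_cancel, neg_zero]

end Elements

/-! ### Elementary column operations and their reductions -/

section ColumnOperations

variable {n : ℕ} {R : Type*} [CommRing R]

/-- The element of the Levi subgroup acting on columns from the right by adding to the column `j`
the combination of the columns with coefficients `b`. -/
def colOp (b : Fin n → R) (j : Fin n) (hb : b j = 0) : Sp n R :=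
  levi (1 + vecMulVec b (Pi.single j 1)) (1 - vecMulVec b (Pi.single j 1)) (by
    have : vecMulVec b (Pi.single j 1) * vecMulVec b (Pi.single j 1) = 0 := by
      rw [vecMulVec_mul_vecMulVec]
      simp [hb]
    rw [sub_mul, one_mul, mul_add, this]
    simp)

theorem colOp_toBlocks₁₁_apply (b : Fin n → R) (j : Fin n) (hb : b j = 0) (i k : Fin n) :
    (colOp b j hb).1.toBlocks₁₁ i k = (1 : Matrix (Fin n) (Fin n) R) i k +
      if k = j then b i else 0 := by
  simp [colOp, levi, vecMulVec_apply, Pi.single_apply]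

theorem mul_colOp_apply (g : Sp n R) (b : Fin n → R) (j : Fin n) (hb : b j = 0) (i k : Fin n) :
    (g * colOp b j hb).1.toBlocks₂₁ i k = g.1.toBlocks₂₁ i k +
      if k = j then (g.1.toBlocks₂₁ *ᵥ b) i else 0 := by
  rw [mul_toBlocks₂₁]
  simp only [colOp, levi, toBlocks_fromBlocks₁₁, toBlocks_fromBlocks₂₁, mul_zero, mul_add,
    mul_one, Matrix.add_apply, mul_vecMulVec, vecMulVec_apply, Pi.single_apply, mul_ite,
    Matrix.zero_apply, add_zero]

theorem colOp_mem_parabolic {r : ℕ} (h : r ≤ n) (b : Fin n → R) (j : Fin n) (hb : b j = 0)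
    (hbr : r ≤ j → ∀ i : Fin n, (i : ℕ) < r → b i = 0) : colOp b j hb ∈ parabolic R h := by
  rw [mem_parabolic_iff]
  intro k hk i
  refine ⟨rfl, fun hi => ?_⟩
  change (colOp b j hb).1.toBlocks₁₁ i k = 0
  rw [colOp_toBlocks₁₁_apply, one_apply_ne (by rintro rfl; omega), zero_add]
  split_ifs with hkj
  · exact hbr (hkj ▸ hk) i hi
  · rfl

theorem upper_mem_parabolic {r : ℕ} (h : r ≤ n) (S : Matrix (Fin n) (Fin n) R) (hS : Sᵀ = S) :
    upper S hS ∈ parabolic R h := by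
  rw [mem_parabolic_iff]
  intro k hk i
  refine ⟨rfl, fun hi => ?_⟩
  change (1 : Matrix (Fin n) (Fin n) R) i k = 0
  exact one_apply_ne (by rintro rfl; omega)

theorem lower_mem_parabolic {r : ℕ} (h : r ≤ n) (S : Matrix (Fin n) (Fin n) R) (hS : Sᵀ = S)
    (hSr : ∀ i j : Fin n, r ≤ j → S i j = 0) : lower S hS ∈ parabolic R h := by
  rw [mem_parabolic_iff]
  intro k hk i
  refine ⟨hSr i k hk, fun hi => ?_⟩
  change (1 : Matrix (Fin n) (Fin n) R) i k = 0
  exact one_apply_ne (by rintro rfl; omega)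

variable {S : Type*} [CommRing S]

theorem upper_map (f : R →+* S) (M : Matrix (Fin n) (Fin n) R) (hM : Mᵀ = M) :
    Sp.map n f (upper M hM) = upper (M.map f) (by rw [← transpose_map, hM]) := by
  apply Subtype.ext
  change (fromBlocks _ _ _ _).map f = fromBlocks _ _ _ _
  rw [fromBlocks_map, Matrix.map_one f (map_zero f) (map_one f), Matrix.map_zero f (map_zero f)]

theorem lower_map (f : R →+* S) (M : Matrix (Fin n) (Fin n) R) (hM : Mᵀ = M) :
    Sp.map n f (lower M hM) = lower (M.map f) (by rw [← transpose_map, hM]) := by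
  apply Subtype.ext
  change (fromBlocks _ _ _ _).map f = fromBlocks _ _ _ _
  rw [fromBlocks_map, Matrix.map_one f (map_zero f) (map_one f), Matrix.map_zero f (map_zero f)]

theorem colOp_map (f : R →+* S) (b : Fin n → R) (j : Fin n) (hb : b j = 0) :
    Sp.map n f (colOp b j hb) = colOp (f ∘ b) j (by simp [hb]) := by
  have h : (vecMulVec b (Pi.single j 1)).map f = vecMulVec (f ∘ b) (Pi.single j 1) := by
    ext i k
    by_cases hk : k = j <;> simp [vecMulVec_apply, hk]
  apply Subtype.ext
  change (fromBlocks _ _ _ _).map f = fromBlocks _ _ _ _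
  rw [fromBlocks_map, Matrix.map_zero f (map_zero f), transpose_map,
    Matrix.map_add f (map_add f), Matrix.map_sub f (map_sub f),
    Matrix.map_one f (map_zero f) (map_one f), h]

theorem upper_zero (h : (0 : Matrix (Fin n) (Fin n) R)ᵀ = 0) : upper 0 h = 1 :=
  Subtype.ext fromBlocks_one

theorem lower_zero (h : (0 : Matrix (Fin n) (Fin n) R)ᵀ = 0) : lower 0 h = 1 :=
  Subtype.ext fromBlocks_one

theorem colOp_zero (j : Fin n) (h : (0 : Fin n → R) j = 0) : colOp 0 j h = 1 := by
  apply Subtype.ext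
  change fromBlocks _ _ _ _ = _
  simp [← fromBlocks_one]

end ColumnOperations

/-! ### Column reduction over a field -/

section Local

variable {n : ℕ} {F : Type*} [Field F]

/-- Each row of `E` vanishes on the common kernel of the rows of `C`, hence is a combination of
them. -/
theorem exists_mul_eq_of_ker_le {m : ℕ} (C E : Matrix (Fin m) (Fin n) F)
    (h : ∀ x, C *ᵥ x = 0 → E *ᵥ x = 0) : ∃ H : Matrix (Fin m) (Fin m) F, H * C = E := by
  have key : ∀ i, ∃ c : Fin m → F, c ᵥ* C = E i := by
    intro i
    have := FiniteDimensional.mem_span_of_iInf_ker_le_ker (𝕜 := F)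
      (L := fun k => (LinearMap.proj k : (Fin m → F) →ₗ[F] F) ∘ₗ C.mulVecLin)
      (K := (LinearMap.proj i : (Fin m → F) →ₗ[F] F) ∘ₗ E.mulVecLin) (by
        intro x hx
        simp only [Submodule.mem_iInf, LinearMap.mem_ker, LinearMap.comp_apply, LinearMap.proj_apply,
          mulVecLin_apply] at hx ⊢
        rw [h x (funext hx)]
        rfl)
    obtain ⟨c, hc⟩ := (Submodule.mem_span_range_iff_exists_fun F).1 this
    refine ⟨c, funext fun j => ?_⟩
    have := congrArg (fun f => f (Pi.single j 1)) hc
    simpa [vecMul, dotProduct] using this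
  choose H hH using key
  exact ⟨H, funext fun i => hH i⟩

/-- The indices `i` and `j` lie in the same of the three blocks given by `s ≤ r`. -/
def SameBlock (r s : ℕ) (i j : Fin n) : Prop :=
  (r ≤ (i : ℕ) ↔ r ≤ (j : ℕ)) ∧ (s ≤ (i : ℕ) ↔ s ≤ (j : ℕ))

/-- The part of `I` in each of the blocks is an initial segment. -/
def BlockInitial (r s : ℕ) (I : Finset (Fin n)) : Prop :=
  ∀ i j : Fin n, j < i → SameBlock r s i j → i ∈ I → j ∈ I

/-- Column reduction with the weight `∑ (j + 1)` of the set of possibly nonzero columns as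
termination measure; the `+ 1` makes removing the index `0` count. A dependent column is cleared,
otherwise a column is moved to a free earlier position of its block. The group `L` stays abstract
because it will be the group of liftable elements. -/
theorem exists_independent_columns (r s : ℕ) (L : Subgroup (Sp n F))
    (hL : ∀ (b : Fin n → F) (j : Fin n) (hb : b j = 0),
      (r ≤ j → ∀ i : Fin n, (i : ℕ) < r → b i = 0) →
      (s ≤ j → ∀ i : Fin n, (i : ℕ) < s → b i = 0) → colOp b j hb ∈ L)
    (k : ℕ) : ∀ (g : Sp n F) (I : Finset (Fin n)), (∀ j ∉ I, ∀ i, g.1.toBlocks₂₁ i j = 0) →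
      ∑ j ∈ I, ((j : ℕ) + 1) = k →
      ∃ q ∈ L, ∃ I', (g * q).1.toBlocks₂₁ * ind F I' = (g * q).1.toBlocks₂₁ ∧
        (∀ x, (g * q).1.toBlocks₂₁ *ᵥ x = 0 → ind F I' *ᵥ x = 0) ∧ BlockInitial r s I' := by
  classical
  induction k using Nat.strong_induction_on with
  | _ k ih =>
  intro g I hI hk
  have hCI : g.1.toBlocks₂₁ * ind F I = g.1.toBlocks₂₁ := by
    ext i j
    rw [mul_ind_apply]
    split_ifs with hj
    · rfl
    · rw [hI j hj]
  have step : ∀ q ∈ L, ∀ I' : Finset (Fin n),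
      (∀ j ∉ I', ∀ i, (g * q).1.toBlocks₂₁ i j = 0) →
      ∑ j ∈ I', ((j : ℕ) + 1) < k →
      ∃ q ∈ L, ∃ I', (g * q).1.toBlocks₂₁ * ind F I' = (g * q).1.toBlocks₂₁ ∧
        (∀ x, (g * q).1.toBlocks₂₁ *ᵥ x = 0 → ind F I' *ᵥ x = 0) ∧ BlockInitial r s I' := by
    intro q hq I' hI' hlt
    obtain ⟨q', hq', I'', h⟩ := ih _ hlt (g * q) I' hI' rfl
    exact ⟨q * q', mul_mem hq hq', I'', by rwa [← mul_assoc]⟩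
  by_cases hA : ∀ x, g.1.toBlocks₂₁ *ᵥ x = 0 → ind F I *ᵥ x = 0
  · by_cases hB : BlockInitial r s I
    · exact ⟨1, one_mem _, I, by rwa [mul_one], by rwa [mul_one], hB⟩
    · simp only [BlockInitial, not_forall] at hB
      obtain ⟨i, j, hji, ⟨hr, hs⟩, hi, hj⟩ := hB
      have hne : i ≠ j := hji.ne'
      have hbj : (Pi.single i 1 : Fin n → F) j = 0 := by simp [hne.symm]
      have hbi : (Pi.single j (-1) : Fin n → F) i = 0 := by simp [hne]
      -- The zero column `j` receives a copy of column `i`, which is then subtracted from column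
      -- `i`.
      refine step (colOp _ j hbj * colOp _ i hbi) (mul_mem (hL _ _ _ ?_ ?_) (hL _ _ _ ?_ ?_))
        (insert j (I.erase i)) ?_ ?_
      · intro h k hk
        rw [Pi.single_eq_of_ne]
        rintro rfl
        omega
      · intro h k hk
        rw [Pi.single_eq_of_ne]
        rintro rfl
        omega
      · intro h k hk
        rw [Pi.single_eq_of_ne]
        rintro rfl
        omega
      · intro h k hk
        rw [Pi.single_eq_of_ne]
        rintro rfl
        omega
      · intro k hk a
        simp only [Finset.mem_insert, Finset.mem_erase, not_or, not_and] at hk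
        rw [← mul_assoc, mul_colOp_apply]
        simp only [mulVec_single, Pi.smul_apply, MulOpposite.op_neg, MulOpposite.op_one, neg_smul,
          one_smul, col_apply, mul_colOp_apply]
        by_cases hki : k = i
        · subst hki
          simp [hne, hI j hj]
        · simp [hki, hk.1, hI k (hk.2 hki)]
      · rw [Finset.sum_insert (by simp [hj]), ← hk, ← Finset.add_sum_erase I _ hi]
        have : (j : ℕ) < i := hji
        omega
  · push Not at hA
    obtain ⟨x, hx, hx'⟩ := hA
    set y := ind F I *ᵥ x with hy
    have hCy : g.1.toBlocks₂₁ *ᵥ y = 0 := by rw [hy, mulVec_mulVec, hCI, hx]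
    obtain ⟨j₁, hj₁⟩ := Function.ne_iff.1 hx'
    have hne : (Finset.univ.filter fun j => y j ≠ 0).Nonempty := ⟨j₁, by simpa using hj₁⟩
    -- Clearing the smallest column in the relation uses only later columns, so the operation
    -- respects both flags `r` and `s`.
    obtain ⟨j, hj, hmin⟩ := Finset.exists_min_image _ id hne
    simp only [Finset.mem_filter, Finset.mem_univ, true_and, id] at hj hmin
    have hjI : j ∈ I := by
      by_contra h
      exact hj (by rw [hy, ind_mulVec, if_neg h])
    have hlt : ∀ i < j, y i = 0 := fun i hi => by
      by_contra h
      exact absurd (hmin i h) (not_le.2 hi)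
    -- The relation scaled to have `j`-th coefficient `1`, with that coefficient removed: adding `C
    -- *ᵥ b` to column `j` gives zero.
    let b : Fin n → F := (y j)⁻¹ • y - Pi.single j 1
    have hb : b j = 0 := by simp [b, hj]
    have hb' : ∀ i < j, b i = 0 := fun i hi => by simp [b, hlt i hi, hi.ne]
    refine step (colOp b j hb) (hL _ _ _ ?_ ?_) (I.erase j) ?_ ?_
    · exact fun h i hi => hb' i (Fin.lt_def.2 (by omega))
    · exact fun h i hi => hb' i (Fin.lt_def.2 (by omega))
    · intro k hk a
      rw [mul_colOp_apply]
      by_cases hkj : k = j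
      · subst hkj
        simp [b, mulVec_sub, mulVec_smul, hCy]
      · have : k ∉ I := fun h => hk (Finset.mem_erase.2 ⟨hkj, h⟩)
        simp [hkj, hI k this]
    · rw [← hk, ← Finset.add_sum_erase I _ hjI]
      omega

/-- The double cosets of the Siegel parabolic subgroup and a group `L` containing sufficiently many
unipotent elements of a parabolic subgroup are represented by Weyl elements. -/
theorem exists_mul_weyl_inv_mem_siegel (r s : ℕ) (L : Subgroup (Sp n F))
    (hL : ∀ (b : Fin n → F) (j : Fin n) (hb : b j = 0),
      (r ≤ j → ∀ i : Fin n, (i : ℕ) < r → b i = 0) →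
      (s ≤ j → ∀ i : Fin n, (i : ℕ) < s → b i = 0) → colOp b j hb ∈ L)
    (hU : ∀ S hS, upper S hS ∈ L)
    (hV : ∀ S hS, (∀ i j : Fin n, s ≤ j → S i j = 0) → lower S hS ∈ L) (g : Sp n F) :
    ∃ q ∈ L, ∃ I : Finset (Fin n), (∀ i ∈ I, s ≤ (i : ℕ)) ∧ BlockInitial r s I ∧
      g * q * (weyl F I)⁻¹ ∈ siegel n F := by
  obtain ⟨q, hq, I, h1, h2, h3⟩ := exists_independent_columns r s L hL _ g Finset.univ
    (fun j hj => absurd (Finset.mem_univ j) hj) rfl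
  obtain ⟨H, hH⟩ := exists_mul_eq_of_ker_le _ _ h2
  obtain ⟨S, hS, h4⟩ := exists_upper_weyl (g * q) I h1 H hH
  -- The part of the Weyl element on indices below `s` belongs to `L` and is absorbed into `q`.
  have hI : I = I.filter (fun i : Fin n => s ≤ (i : ℕ)) ∪ I.filter (fun i : Fin n => ¬ s ≤ (i : ℕ)) :=
    (Finset.filter_union_filter_not_eq _ _).symm
  rw [hI, weyl_union (Finset.disjoint_filter_filter_not _ _ _), _root_.mul_inv_rev] at h4
  refine ⟨q * upper S hS * (weyl F (I.filter fun i : Fin n => ¬ s ≤ (i : ℕ)))⁻¹,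
    mul_mem (mul_mem hq (hU _ _)) ?_, I.filter fun i : Fin n => s ≤ (i : ℕ), ?_, ?_, ?_⟩
  · rw [weyl_inv]
    refine mul_mem (mul_mem (hU _ _) (hV _ _ ?_)) (hU _ _)
    intro i j hj
    simp only [ind, Finset.mem_filter, Matrix.neg_apply, diagonal_apply, neg_eq_zero]
    split_ifs with h5 h6
    · exact absurd (h5 ▸ hj) h6.2
    · rfl
    · rfl
  · intro i hi
    exact (Finset.mem_filter.1 hi).2
  · intro i j hji hb hi
    rw [Finset.mem_filter] at hi ⊢
    exact ⟨h3 i j hji hb hi.1, hb.2.1 hi.2⟩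
  · simpa only [mul_assoc] using h4

end Local

/-! ### The rank invariant -/

section Rank

variable {n : ℕ} {F : Type*} [Field F]

/-- The codimension of `f(K)` in `f(E)` is at most that of `K` in `E`. -/
theorem finrank_map_le_add {V W : Type*} [AddCommGroup V] [Module F V] [FiniteDimensional F V]
    [AddCommGroup W] [Module F W] (f : V →ₗ[F] W) {K E : Submodule F V} (h : K ≤ E) :
    Module.finrank F (E.map f) + Module.finrank F K ≤
      Module.finrank F (K.map f) + Module.finrank F E := by
  have hE := LinearMap.finrank_range_add_finrank_ker (f.domRestrict E)
  have hK := LinearMap.finrank_range_add_finrank_ker (f.domRestrict K)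
  rw [LinearMap.range_domRestrict] at hE hK
  have : Module.finrank F (LinearMap.ker (f.domRestrict K)) ≤
      Module.finrank F (LinearMap.ker (f.domRestrict E)) := by
    rw [← Submodule.finrank_map_subtype_eq, ← Submodule.finrank_map_subtype_eq E]
    apply Submodule.finrank_mono
    rintro _ ⟨⟨x, hx⟩, hx', rfl⟩
    exact ⟨⟨x, h hx⟩, hx', rfl⟩
  omega

theorem finrank_map_of_injective {V W : Type*} [AddCommGroup V] [Module F V]
    [AddCommGroup W] [Module F W] (f : V →ₗ[F] W) (hf : Function.Injective f) (E : Submodule F V) :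
    Module.finrank F (E.map f) = Module.finrank F E :=
  (Submodule.equivMapOfInjective f hf E).finrank_eq.symm

theorem finrank_map_of_injOn {V W : Type*} [AddCommGroup V] [Module F V] [FiniteDimensional F V]
    [AddCommGroup W] [Module F W] (f : V →ₗ[F] W) (E : Submodule F V)
    (hf : ∀ x ∈ E, f x = 0 → x = 0) :
    Module.finrank F (E.map f) = Module.finrank F E := by
  have := finrank_map_of_injective (f.domRestrict E) (by
    rw [← LinearMap.ker_eq_bot, LinearMap.ker_eq_bot']
    exact fun x hx => Subtype.ext (hf x.1 x.2 hx)) ⊤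
  rwa [Submodule.map_top, LinearMap.range_domRestrict, finrank_top] at this

theorem map_eq_of_eqOn {V W : Type*} [AddCommGroup V] [Module F V]
    [AddCommGroup W] [Module F W] {f g : V →ₗ[F] W} {E : Submodule F V}
    (h : ∀ v ∈ E, f v = g v) : E.map f = E.map g := by
  ext w
  exact ⟨fun ⟨v, hv, e⟩ => ⟨v, hv, (h v hv).symm.trans e⟩,
    fun ⟨v, hv, e⟩ => ⟨v, hv, (h v hv).trans e⟩⟩

/-- The span of the unit vectors with index in `K`. -/
def coordSub (F : Type*) [Field F] (K : Finset (Fin n)) : Submodule F (Fin n → F) where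
  carrier := {v | ∀ i ∉ K, v i = 0}
  add_mem' hv hw i hi := by simp [hv i hi, hw i hi]
  zero_mem' _ _ := rfl
  smul_mem' c v hv i hi := by simp [hv i hi]

theorem finrank_coordSub (K : Finset (Fin n)) : Module.finrank F (coordSub F K) = K.card := by
  have h1 : coordSub F K =
      LinearMap.ker (LinearMap.funLeft F F (Subtype.val : {i // i ∉ K} → Fin n)) := by
    ext v
    rw [LinearMap.mem_ker, funext_iff, Subtype.forall]
    rfl
  have h2 := LinearMap.finrank_range_add_finrank_ker
    (LinearMap.funLeft F F (Subtype.val : {i // i ∉ K} → Fin n))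
  rw [LinearMap.range_eq_top.2 (LinearMap.funLeft_surjective_of_injective F F _
    Subtype.val_injective), finrank_top, ← h1] at h2
  simp only [Module.finrank_pi, Fintype.card_fin, Fintype.card_subtype_compl,
    Fintype.card_coe] at h2
  have := K.card_le_univ
  rw [Fintype.card_fin] at this
  omega

/-- The indices that are at least `t`. -/
def tail (n t : ℕ) : Finset (Fin n) := Finset.univ.filter fun i => t ≤ (i : ℕ)

theorem mem_tail {t : ℕ} {i : Fin n} : i ∈ tail n t ↔ t ≤ (i : ℕ) := by simp [tail]

theorem card_tail (t : ℕ) : (tail n t).card = n - t := by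
  have h : (tail n t).map Fin.valEmbedding = Finset.Ico t n := by
    ext i
    simp only [Finset.mem_map, mem_tail, Fin.valEmbedding_apply, Finset.mem_Ico]
    exact ⟨fun ⟨a, h, e⟩ => by omega, fun h => ⟨⟨i, h.2⟩, h.1, rfl⟩⟩
  rw [← Finset.card_map, h, Nat.card_Ico]

/-- The rank of the lower half of the last `n - t` columns of the left half of `g`. -/
noncomputable def lowerRank (g : Sp n F) (t : ℕ) : ℕ :=
  Module.finrank F ((coordSub F (tail n t)).map g.1.toBlocks₂₁.mulVecLin)

theorem transpose_mul_sub (g : Sp n F) :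
    g.1.toBlocks₁₁ᵀ * g.1.toBlocks₂₂ - g.1.toBlocks₂₁ᵀ * g.1.toBlocks₁₂ = 1 := by
  have h := g.2
  rw [← fromBlocks_toBlocks g.1, SymplecticGroup.fromBlocks_mem_iff] at h
  exact h.2.2

/-- The matrix `h` embeds the coordinate space of dimension `n - t` into the one of dimension `n -
s`, and `d` acts on lower halves by an invertible block. So the images of a space and of a subspace
of codimension `t - s` under the lower left block of `g` are compared. -/
theorem lowerRank_mul {s t : ℕ} {d : Sp n F} (hd : d ∈ siegel n F) (g : Sp n F)
    {h : Sp n F} (hh : ColSupp t s h.1) (hst : s ≤ t) (ht : t ≤ n) :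
    lowerRank (d * g * h) t ≤ lowerRank g s ∧
      lowerRank g s ≤ lowerRank (d * g * h) t + (t - s) := by
  rw [mem_siegel_iff] at hd
  set f := g.1.toBlocks₂₁.mulVecLin with hf
  set K := (coordSub F (tail n t)).map h.1.toBlocks₁₁.mulVecLin with hK
  have h21 : ∀ v ∈ coordSub F (tail n t), h.1.toBlocks₂₁ *ᵥ v = 0 := by
    intro v hv
    ext i
    change ∑ j, h.1.toBlocks₂₁ i j * v j = 0
    refine Finset.sum_eq_zero fun j _ => ?_
    by_cases hj : j ∈ tail n t
    · exact mul_eq_zero_of_left (hh j (mem_tail.1 hj) i).1 (v j)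
    · exact mul_eq_zero_of_right _ (hv j hj)
  have hmap : (coordSub F (tail n t)).map (d * g * h).1.toBlocks₂₁.mulVecLin =
      (K.map f).map d.1.toBlocks₂₂.mulVecLin := by
    rw [hK, ← Submodule.map_comp, ← Submodule.map_comp]
    refine map_eq_of_eqOn fun v hv => ?_
    simp only [LinearMap.comp_apply, mulVecLin_apply, hf]
    rw [mul_toBlocks₂₁, mul_toBlocks₂₁, hd, add_mulVec, ← mulVec_mulVec _ _ h.1.toBlocks₂₁,
      h21 v hv, mulVec_zero, add_zero, zero_mul, zero_add, mulVec_mulVec, mulVec_mulVec,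
      Matrix.mul_assoc]
  have hD : Function.Injective d.1.toBlocks₂₂.mulVecLin := by
    have := transpose_mul_sub d
    rw [hd, transpose_zero, zero_mul, sub_zero] at this
    intro x y hxy
    have h2 := congrArg (fun v => d.1.toBlocks₁₁ᵀ *ᵥ v) hxy
    simpa [mulVecLin_apply, mulVec_mulVec, this] using h2
  have hKE : K ≤ coordSub F (tail n s) := by
    rintro _ ⟨v, hv, rfl⟩ i hi
    rw [mem_tail, not_le] at hi
    change ∑ j, h.1.toBlocks₁₁ i j * v j = 0
    refine Finset.sum_eq_zero fun j _ => ?_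
    by_cases hj : j ∈ tail n t
    · exact mul_eq_zero_of_left ((hh j (mem_tail.1 hj) i).2 hi) _
    · exact mul_eq_zero_of_right _ (hv j hj)
  have hKr : Module.finrank F K = n - t := by
    rw [hK, finrank_map_of_injOn, finrank_coordSub, card_tail]
    intro v hv hv'
    have h1 := congrArg transpose (transpose_mul_sub h)
    rw [transpose_sub, transpose_mul, transpose_mul, transpose_one, transpose_transpose,
      transpose_transpose] at h1
    -- Both `A v` and `C v` vanish, so `v = (ᵗD A - ᵗB C) v = 0`.
    rw [← one_mulVec v, ← h1, sub_mulVec, ← mulVec_mulVec, ← mulVec_mulVec, h21 v hv]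
    rw [mulVecLin_apply] at hv'
    rw [hv', mulVec_zero, mulVec_zero, sub_zero]
  have hlr : lowerRank (d * g * h) t = Module.finrank F (K.map f) := by
    rw [lowerRank, hmap, finrank_map_of_injective _ hD]
  rw [hlr]
  refine ⟨Submodule.finrank_mono (Submodule.map_mono hKE), ?_⟩
  have := finrank_map_le_add f hKE
  rw [hKr, finrank_coordSub, card_tail] at this
  rw [lowerRank, ← hf]
  omega

theorem lowerRank_le (g : Sp n F) (t : ℕ) : lowerRank g t ≤ n - t := by
  rw [← card_tail, ← finrank_coordSub (F := F)]
  exact Submodule.finrank_map_le _ _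

theorem lowerRank_weyl (I : Finset (Fin n)) (t : ℕ) :
    lowerRank (weyl F I) t = (I ∩ tail n t).card := by
  rw [lowerRank, ← finrank_coordSub (F := F)]
  suffices h : (coordSub F (tail n t)).map (weyl F I).1.toBlocks₂₁.mulVecLin =
      coordSub F (I ∩ tail n t) by rw [h]
  ext v
  change v ∈ Submodule.map (ind F I).mulVecLin _ ↔ _
  constructor
  · rintro ⟨w, hw, rfl⟩ i hi
    rw [mulVecLin_apply, ind_mulVec]
    split_ifs with h
    · exact hw i fun h' => hi (Finset.mem_inter.2 ⟨h, h'⟩)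
    · rfl
  · intro hv
    refine ⟨v, fun i hi => hv i fun h => hi (Finset.mem_inter.1 h).2, ?_⟩
    ext i
    rw [mulVecLin_apply, ind_mulVec]
    split_ifs with h
    · rfl
    · exact (hv i fun h' => h (Finset.mem_inter.1 h').1).symm

theorem lowerRank_mul_parabolic {t : ℕ} (ht : t ≤ n) {d : Sp n F} (hd : d ∈ siegel n F) (g : Sp n F)
    {h : Sp n F} (hh : h ∈ parabolic F ht) :
    lowerRank (d * g * h) t = lowerRank g t := by
  have := lowerRank_mul hd g ((mem_parabolic_iff ht h).1 hh) le_rfl ht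
  omega

end Rank

/-! ### Lifting unipotents from residue fields to the integers -/

section Lift

variable {n : ℕ}

/-- Reduction modulo `p`. -/
abbrev red (n p : ℕ) : Sp n ℤ →* Sp n (ZMod p) := Sp.map n (Int.castRingHom (ZMod p))

/-- The matrices that are trivial modulo all primes dividing `N` other than `p`. -/
def trivialAway (n N p : ℕ) : Subgroup (Sp n ℤ) := ⨅ q ∈ N.primeFactors.erase p, (red n q).ker

theorem mem_trivialAway {N p : ℕ} {x : Sp n ℤ} :
    x ∈ trivialAway n N p ↔ ∀ q ∈ N.primeFactors.erase p, red n q x = 1 := by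
  simp only [trivialAway, Subgroup.mem_iInf, MonoidHom.mem_ker]

/-- The elements modulo `p` that lift to `Q` with trivial reductions at the other primes. -/
def liftable (N p : ℕ) (Q : Subgroup (Sp n ℤ)) : Subgroup (Sp n (ZMod p)) :=
  (Q ⊓ trivialAway n N p).map (red n p)

/-- Lifts are multiplied by an integer that is `1` modulo `p` and `0` modulo the other primes. The
condition `f 0 = 0` keeps entrywise lifts of unipotents in the parabolic subgroups. -/
theorem exists_lift_fun {N p : ℕ} (hp : p ∈ N.primeFactors) :
    ∃ f : ZMod p → ℤ, (∀ x, (f x : ZMod p) = x) ∧ f 0 = 0 ∧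
      ∀ q ∈ N.primeFactors.erase p, ∀ x, (f x : ZMod q) = 0 := by
  have hco : Nat.Coprime p (∏ q ∈ N.primeFactors.erase p, q) := by
    refine Nat.Coprime.prod_right fun q hq => ?_
    rw [Finset.mem_erase] at hq
    exact (Nat.coprime_primes (Nat.prime_of_mem_primeFactors hp)
      (Nat.prime_of_mem_primeFactors hq.2)).2 hq.1.symm
  obtain ⟨e, he1, he2⟩ := Nat.chineseRemainder hco 1 0
  refine ⟨fun x => e * (x.cast : ℤ), fun x => ?_, by simp, fun q hq x => ?_⟩
  · have : (e : ZMod p) = 1 := by simpa using (ZMod.natCast_eq_natCast_iff _ _ _).2 he1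
    rw [Int.cast_mul, Int.cast_natCast, this, one_mul, ZMod.intCast_zmod_cast]
  · have : (e : ZMod q) = 0 := by
      rw [ZMod.natCast_eq_zero_iff]
      exact (Finset.dvd_prod_of_mem _ hq).trans ((Nat.modEq_zero_iff_dvd).1 he2)
    rw [Int.cast_mul, Int.cast_natCast, this, zero_mul]

/-- The lift for `p` is trivial at the other primes, so multiplying the lifts changes one reduction
at a time. -/
theorem exists_glue {N : ℕ} (Q : Subgroup (Sp n ℤ)) (f : ∀ p, Sp n (ZMod p))
    (hf : ∀ p ∈ N.primeFactors, f p ∈ liftable N p Q) :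
    ∃ q ∈ Q, ∀ p ∈ N.primeFactors, red n p q = f p := by
  have key : ∀ S ⊆ N.primeFactors, ∃ q ∈ Q, (∀ p ∈ S, red n p q = f p) ∧
      ∀ p ∈ N.primeFactors, p ∉ S → red n p q = 1 := by
    intro S
    induction S using Finset.induction_on with
    | empty => exact fun _ => ⟨1, one_mem _, by simp, fun p _ _ => map_one _⟩
    | insert p S hpS ih =>
      intro hS
      obtain ⟨q, hq, h1, h2⟩ := ih ((Finset.subset_insert _ _).trans hS)
      have hp := hS (Finset.mem_insert_self p S)
      obtain ⟨x, ⟨hxQ, hx⟩, hxp⟩ := hf p hp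
      replace hx := mem_trivialAway.1 hx
      refine ⟨q * x, mul_mem hq hxQ, fun p' hp' => ?_, fun p' hp' hp'' => ?_⟩
      · rw [map_mul]
        rcases Finset.mem_insert.1 hp' with rfl | h
        · rw [h2 _ hp hpS, hxp, one_mul]
        · have hne : p' ≠ p := fun e => hpS (e ▸ h)
          rw [h1 _ h, hx _ (Finset.mem_erase.2 ⟨hne, hS hp'⟩), mul_one]
      · rw [Finset.mem_insert, not_or] at hp''
        rw [map_mul, h2 _ hp' hp''.2, hx _ (Finset.mem_erase.2 ⟨hp''.1, hp'⟩), mul_one]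
  obtain ⟨q, hq, h, -⟩ := key _ subset_rfl
  exact ⟨q, hq, h⟩

variable {N p r s : ℕ}

theorem upper_mem_liftable (hp : p ∈ N.primeFactors) (hr : r ≤ n) (hs : s ≤ n)
    (S : Matrix (Fin n) (Fin n) (ZMod p)) (hS : Sᵀ = S) :
    upper S hS ∈ liftable N p (parabolic ℤ hr ⊓ parabolic ℤ hs) := by
  obtain ⟨f, h1, h2, h3⟩ := exists_lift_fun hp
  have hS' : (S.map f)ᵀ = S.map f := by rw [← transpose_map, hS]
  refine ⟨upper (S.map f) hS', ⟨⟨upper_mem_parabolic hr _ _, upper_mem_parabolic hs _ _⟩, ?_⟩, ?_⟩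
  · refine mem_trivialAway.2 fun q hq => ?_
    rw [upper_map, ← upper_zero transpose_zero]
    congr 1
    ext i j
    exact h3 q hq _
  · rw [upper_map]
    congr 1
    ext i j
    exact h1 _

theorem lower_mem_liftable (hp : p ∈ N.primeFactors) (hr : r ≤ n) (hs : s ≤ n)
    (hsr : s ≤ r) (S : Matrix (Fin n) (Fin n) (ZMod p)) (hS : Sᵀ = S)
    (hSs : ∀ i j : Fin n, s ≤ j → S i j = 0) :
    lower S hS ∈ liftable N p (parabolic ℤ hr ⊓ parabolic ℤ hs) := by
  obtain ⟨f, h1, h2, h3⟩ := exists_lift_fun hp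
  have hS' : (S.map f)ᵀ = S.map f := by rw [← transpose_map, hS]
  have h0 : ∀ i j : Fin n, s ≤ j → S.map f i j = 0 := fun i j hj => by
    rw [Matrix.map_apply, hSs i j hj, h2]
  refine ⟨lower (S.map f) hS', ⟨⟨lower_mem_parabolic hr _ _ fun i j hj => h0 i j (hsr.trans hj),
    lower_mem_parabolic hs _ _ h0⟩, ?_⟩, ?_⟩
  · refine mem_trivialAway.2 fun q hq => ?_
    rw [lower_map, ← lower_zero transpose_zero]
    congr 1
    ext i j
    exact h3 q hq _
  · rw [lower_map]
    congr 1
    ext i j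
    exact h1 _

theorem colOp_mem_liftable (hp : p ∈ N.primeFactors) (hr : r ≤ n) (hs : s ≤ n)
    (b : Fin n → ZMod p) (j : Fin n) (hb : b j = 0)
    (hbr : r ≤ j → ∀ i : Fin n, (i : ℕ) < r → b i = 0)
    (hbs : s ≤ j → ∀ i : Fin n, (i : ℕ) < s → b i = 0) :
    colOp b j hb ∈ liftable N p (parabolic ℤ hr ⊓ parabolic ℤ hs) := by
  obtain ⟨f, h1, h2, h3⟩ := exists_lift_fun hp
  have hb' : (f ∘ b) j = 0 := by simp [hb, h2]
  refine ⟨colOp (f ∘ b) j hb',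
    ⟨⟨colOp_mem_parabolic hr _ _ _ fun h i hi => by simp [hbr h i hi, h2],
      colOp_mem_parabolic hs _ _ _ fun h i hi => by simp [hbs h i hi, h2]⟩, ?_⟩, ?_⟩
  · refine mem_trivialAway.2 fun q hq => ?_
    rw [colOp_map, ← colOp_zero j rfl]
    congr 1
    ext i
    exact h3 q hq _
  · rw [colOp_map]
    congr 1
    ext i
    exact h1 _

end Lift

/-! ### Double cosets of `Γ₀(N)` and pairs of parabolics -/

section DoubleCosets

variable {n : ℕ}

theorem dvd_of_squarefree {N : ℕ} (hN : Squarefree N) {x : ℤ}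
    (h : ∀ p ∈ N.primeFactors, (p : ℤ) ∣ x) : (N : ℤ) ∣ x := by
  rw [← Nat.prod_primeFactors_of_squarefree hN, ← Int.dvd_natAbs, Int.natCast_dvd_natCast]
  refine Finset.prod_primes_dvd _ (fun p hp => (Nat.prime_of_mem_primeFactors hp).prime) ?_
  intro p hp
  rw [← Int.natCast_dvd_natCast, Int.dvd_natAbs]
  exact h p hp

theorem map_mem_Gamma0_iff {N : ℕ} (hN : Squarefree N) (g : Sp n ℤ) :
    Sp.map n (Int.castRingHom ℚ) g ∈ Gamma0 n N ↔
      ∀ p ∈ N.primeFactors, red n p g ∈ siegel n (ZMod p) := by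
  constructor
  · rintro ⟨g', hg', h⟩ p hp
    cases Sp.map_injective (RingHom.injective_int (Int.castRingHom ℚ)) h
    rw [mem_siegel_iff]
    ext i j
    exact (ZMod.intCast_zmod_eq_zero_iff_dvd _ _).2
      ((Int.natCast_dvd_natCast.2 (Nat.dvd_of_mem_primeFactors hp)).trans (hg' i j))
  · intro h
    refine ⟨g, fun i j => dvd_of_squarefree hN fun p hp => ?_, rfl⟩
    have := h p hp
    rw [mem_siegel_iff] at this
    exact (ZMod.intCast_zmod_eq_zero_iff_dvd _ _).1 (congrFun (congrFun this i) j)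

theorem exists_map_of_mem_Gamma0 {N : ℕ} {x : Sp n ℚ} (hx : x ∈ Gamma0 n N) :
    ∃ g : Sp n ℤ, Sp.map n (Int.castRingHom ℚ) g = x := by
  obtain ⟨g, -, hg⟩ := hx
  exact ⟨g, hg⟩

/-- Initial segments of a chain are nested, hence determined by their size. -/
theorem eq_of_initial {K I J : Finset (Fin n)}
    (hI : ∀ i ∈ K, ∀ j ∈ K, j < i → i ∈ I → j ∈ I) (hJ : ∀ i ∈ K, ∀ j ∈ K, j < i → i ∈ J → j ∈ J)
    (h : (I ∩ K).card = (J ∩ K).card) : I ∩ K = J ∩ K := by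
  by_cases hs : I ∩ K ⊆ J ∩ K
  · exact Finset.eq_of_subset_of_card_le hs h.ge
  · by_cases hs' : J ∩ K ⊆ I ∩ K
    · exact (Finset.eq_of_subset_of_card_le hs' h.le).symm
    · obtain ⟨x, hx, hx'⟩ := Finset.not_subset.1 hs
      obtain ⟨y, hy, hy'⟩ := Finset.not_subset.1 hs'
      simp only [Finset.mem_inter, not_and'] at hx hx' hy hy'
      rcases lt_trichotomy x y with hxy | rfl | hxy
      · exact absurd (hJ y hy.2 x hx.2 hxy hy.1) (hx' hx.2)
      · exact absurd hy.1 (hx' hx.2)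
      · exact absurd (hI x hx.2 y hy.2 hxy hx.1) (hy' hy.2)

/-- The two cardinalities give the number of elements in `[r, n)` and, by subtraction, in `[s, r)`;
on each block the set is an initial segment. -/
theorem eq_of_blockInitial {r s : ℕ} (hsr : s ≤ r) {I J : Finset (Fin n)}
    (hI : ∀ i ∈ I, s ≤ (i : ℕ)) (hJ : ∀ i ∈ J, s ≤ (i : ℕ)) (hI' : BlockInitial r s I)
    (hJ' : BlockInitial r s J) (h1 : (I ∩ tail n r).card = (J ∩ tail n r).card)
    (h2 : (I ∩ tail n s).card = (J ∩ tail n s).card) : I = J := by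
  have hsub : tail n r ⊆ tail n s := fun i hi => mem_tail.2 (hsr.trans (mem_tail.1 hi))
  have e1 : I ∩ tail n r = J ∩ tail n r := by
    refine eq_of_initial (fun i hi j hj hji => hI' i j hji ?_)
      (fun i hi j hj hji => hJ' i j hji ?_) h1 <;>
    · rw [mem_tail] at hi hj
      constructor <;> omega
  have e2 : I ∩ (tail n s \ tail n r) = J ∩ (tail n s \ tail n r) := by
    refine eq_of_initial (fun i hi j hj hji => hI' i j hji ?_)
      (fun i hi j hj hji => hJ' i j hji ?_) ?_
    · rw [Finset.mem_sdiff, mem_tail, mem_tail] at hi hj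
      constructor <;> omega
    · rw [Finset.mem_sdiff, mem_tail, mem_tail] at hi hj
      constructor <;> omega
    · have key : ∀ A : Finset (Fin n), (A ∩ (tail n s \ tail n r)).card + (A ∩ tail n r).card =
          (A ∩ tail n s).card := by
        intro A
        rw [← Finset.card_union_of_disjoint, ← Finset.inter_union_distrib_left,
          Finset.sdiff_union_of_subset hsub]
        exact (Finset.sdiff_disjoint).mono Finset.inter_subset_right Finset.inter_subset_right
      have a1 := key I
      have a2 := key J
      omega
  ext i
  have f1 := Finset.ext_iff.1 e1 i
  have f2 := Finset.ext_iff.1 e2 i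
  simp only [Finset.mem_inter, Finset.mem_sdiff, mem_tail] at f1 f2
  have g1 := hI i
  have g2 := hJ i
  by_cases hri : r ≤ (i : ℕ)
  · simpa [hri] using f1
  · by_cases hsi : s ≤ (i : ℕ)
    · simpa [hri, hsi] using f2
    · exact ⟨fun h => absurd (g1 h) hsi, fun h => absurd (g2 h) hsi⟩

/-- A normal form for an integral matrix modulo `P_{n,r} ∩ P_{n,s}`. -/
theorem exists_normal_form {N r s : ℕ} (hr : r ≤ n) (hs : s ≤ n) (hsr : s ≤ r)
    (g : Sp n ℤ) : ∃ q ∈ parabolic ℤ hr ⊓ parabolic ℤ hs, ∃ I : ℕ → Finset (Fin n),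
      ∀ p ∈ N.primeFactors, (∀ i ∈ I p, s ≤ (i : ℕ)) ∧ BlockInitial r s (I p) ∧
        red n p (g * q) * (weyl (ZMod p) (I p))⁻¹ ∈ siegel n (ZMod p) := by
  have key : ∀ p, ∃ q : Sp n (ZMod p), ∃ I : Finset (Fin n), p ∈ N.primeFactors →
      q ∈ liftable N p (parabolic ℤ hr ⊓ parabolic ℤ hs) ∧ (∀ i ∈ I, s ≤ (i : ℕ)) ∧
        BlockInitial r s I ∧ red n p g * q * (weyl (ZMod p) I)⁻¹ ∈ siegel n (ZMod p) := by
    intro p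
    by_cases hp : p ∈ N.primeFactors
    · have : Fact p.Prime := ⟨Nat.prime_of_mem_primeFactors hp⟩
      obtain ⟨q, hq, I, h⟩ := exists_mul_weyl_inv_mem_siegel r s
        (liftable N p (parabolic ℤ hr ⊓ parabolic ℤ hs))
        (fun b j hb h1 h2 => colOp_mem_liftable hp hr hs b j hb h1 h2)
        (upper_mem_liftable hp hr hs) (lower_mem_liftable hp hr hs hsr) (red n p g)
      exact ⟨q, I, fun _ => ⟨hq, h⟩⟩
    · exact ⟨1, ∅, fun h => absurd h hp⟩
  choose f I hf using key
  obtain ⟨q, hq, hqf⟩ := exists_glue _ f fun p hp => (hf p hp).1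
  refine ⟨q, hq, I, fun p hp => ⟨(hf p hp).2.1, (hf p hp).2.2.1, ?_⟩⟩
  rw [map_mul, hqf p hp]
  exact (hf p hp).2.2.2

/-- The double cosets of `Γ₀(N)` and `P_{n,r} ∩ P_{n,s}` are separated by the ranks. -/
theorem exists_of_lowerRank_eq {N r s : ℕ} (hN : Squarefree N) (hr : r ≤ n) (hs : s ≤ n)
    (hsr : s ≤ r) (g₁ g₂ : Sp n ℤ)
    (h₁ : ∀ p ∈ N.primeFactors, ∀ [Fact p.Prime],
      lowerRank (red n p g₁) r = lowerRank (red n p g₂) r)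
    (h₂ : ∀ p ∈ N.primeFactors, ∀ [Fact p.Prime],
      lowerRank (red n p g₁) s = lowerRank (red n p g₂) s) :
    ∃ d : Sp n ℤ, Sp.map n (Int.castRingHom ℚ) d ∈ Gamma0 n N ∧
      ∃ q ∈ parabolic ℤ hr ⊓ parabolic ℤ hs, g₂ = d * g₁ * q := by
  obtain ⟨q₁, hq₁, I₁, h1⟩ := exists_normal_form (N := N) hr hs hsr g₁
  obtain ⟨q₂, hq₂, I₂, h2⟩ := exists_normal_form (N := N) hr hs hsr g₂
  have hI : ∀ p ∈ N.primeFactors, I₁ p = I₂ p := by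
    intro p hp
    have : Fact p.Prime := ⟨Nat.prime_of_mem_primeFactors hp⟩
    have key : ∀ (g q : Sp n ℤ) (I : Finset (Fin n)),
        red n p (g * q) * (weyl (ZMod p) I)⁻¹ ∈ siegel n (ZMod p) → ∀ t (ht : t ≤ n),
        q ∈ parabolic ℤ ht → lowerRank (red n p g) t = (I ∩ tail n t).card := by
      intro g q I hI t ht hq
      have e : red n p g = red n p (g * q) * (weyl (ZMod p) I)⁻¹ * weyl (ZMod p) I *
          red n p q⁻¹ := by
        rw [inv_mul_cancel_right, ← map_mul, mul_inv_cancel_right]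
      rw [e, lowerRank_mul_parabolic ht hI _ (map_mem_parabolic ht _ (inv_mem hq)),
        lowerRank_weyl]
    obtain ⟨a1, a2, a3⟩ := h1 p hp
    obtain ⟨b1, b2, b3⟩ := h2 p hp
    refine eq_of_blockInitial hsr a1 b1 a2 b2 ?_ ?_
    · rw [← key _ _ _ a3 r hr hq₁.1, ← key _ _ _ b3 r hr hq₂.1, h₁ p hp]
    · rw [← key _ _ _ a3 s hs hq₁.2, ← key _ _ _ b3 s hs hq₂.2, h₂ p hp]
  -- Modulo every `p`, both `g₁ * q₁` and `g₂ * q₂` are a Siegel element times the same Weyl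
  -- element, so this quotient is Siegel.
  refine ⟨g₂ * q₂ * (g₁ * q₁)⁻¹, ?_, q₁ * q₂⁻¹, mul_mem hq₁ (inv_mem hq₂), by group⟩
  rw [map_mem_Gamma0_iff hN]
  intro p hp
  have h3 := mul_mem (h2 p hp).2.2 (inv_mem (h1 p hp).2.2)
  rw [hI p hp] at h3
  convert h3 using 1
  rw [map_mul, map_inv]
  group

/-- Weyl elements are products of liftable unipotents; with `r = s = n` the parabolic conditions are
empty. -/
theorem exists_red_eq_weyl {N : ℕ} (I : ℕ → Finset (Fin n)) :
    ∃ g : Sp n ℤ, ∀ p ∈ N.primeFactors, red n p g = weyl (ZMod p) (I p) := by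
  obtain ⟨q, -, h⟩ := exists_glue (N := N) (parabolic ℤ (le_refl n) ⊓ parabolic ℤ (le_refl n))
    (fun p => weyl (ZMod p) (I p)) (by
      intro p hp
      rw [← inv_mem_iff, weyl_inv]
      refine mul_mem (mul_mem (upper_mem_liftable hp _ _ _ _)
        (lower_mem_liftable hp _ _ le_rfl _ _ ?_)) (upper_mem_liftable hp _ _ _ _)
      intro i j hj
      omega)
  exact ⟨q, h⟩

end DoubleCosets

/-! ### Rational matrices as integral times triangular ones -/

section Integral

variable {n : ℕ}

/-- The matrix fixes the upper unit vectors of index `≥ m`. -/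
def FixesFrom (m : ℕ) (g : Sp n ℤ) : Prop :=
  ∀ j : Fin n, m ≤ j → ∀ a, g.1 a (Sum.inl j) =
    (1 : Matrix (Fin n ⊕ Fin n) (Fin n ⊕ Fin n) ℤ) a (Sum.inl j)

theorem FixesFrom.mul {m : ℕ} {g h : Sp n ℤ} (hg : FixesFrom m g) (hh : FixesFrom m h) :
    FixesFrom m (g * h) := by
  intro j hj a
  rw [← hg j hj a, Submonoid.coe_mul, mul_apply]
  conv_rhs => rw [← mul_one g.1, mul_apply]
  exact Finset.sum_congr rfl fun x _ => by rw [hh j hj x]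

/-- The element with diagonal blocks. -/
def diag4 (a b c d : Fin n → ℤ) (h : ∀ i, a i * d i - c i * b i = 1) : Sp n ℤ :=
  ⟨fromBlocks (diagonal a) (diagonal b) (diagonal c) (diagonal d), by
    rw [SymplecticGroup.fromBlocks_mem_iff]
    refine ⟨?_, ?_, ?_⟩
    · simp [mul_comm]
    · simp [mul_comm]
    · simp [diagonal_sub, h]⟩

/-- Bézout coefficients form the first row and `(-y, x)` divided by the gcd the second. -/
theorem exists_sl2 (x y : ℤ) : ∃ a b c d : ℤ, a * d - c * b = 1 ∧ c * x + d * y = 0 := by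
  by_cases h : Int.gcd x y = 0
  · obtain ⟨rfl, rfl⟩ := Int.gcd_eq_zero_iff.1 h
    exact ⟨1, 0, 0, 1, by norm_num, by norm_num⟩
  · have hg : (Int.gcd x y : ℤ) ≠ 0 := by exact_mod_cast h
    obtain ⟨u, hu⟩ := Int.gcd_dvd_left x y
    obtain ⟨v, hv⟩ := Int.gcd_dvd_right x y
    have hb := Int.gcd_eq_gcd_ab x y
    refine ⟨Int.gcdA x y, Int.gcdB x y, -v, u, ?_, ?_⟩
    · apply mul_left_cancel₀ hg
      linear_combination -hb - Int.gcdA x y * hu - Int.gcdB x y * hv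
    · linear_combination (-v) * hu + u * hv

/-- An `SL₂` matrix acts in each plane spanned by an upper and the corresponding lower unit vector;
from index `m` on the identity already does the job. -/
theorem exists_lower_eq_zero (m : ℕ) (z : Fin n ⊕ Fin n → ℤ)
    (hz : ∀ j : Fin n, m ≤ j → z (Sum.inr j) = 0) :
    ∃ g : Sp n ℤ, FixesFrom m g ∧ ∃ x : Fin n → ℤ, g.1 *ᵥ z = Sum.elim x 0 := by
  have key : ∀ i : Fin n, ∃ a b c d : ℤ, a * d - c * b = 1 ∧
      c * z (Sum.inl i) + d * z (Sum.inr i) = 0 ∧ (m ≤ i → a = 1 ∧ c = 0) := by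
    intro i
    by_cases hi : m ≤ i
    · exact ⟨1, 0, 0, 1, by norm_num, by rw [hz i hi]; norm_num, fun _ => ⟨rfl, rfl⟩⟩
    · obtain ⟨a, b, c, d, h1, h2⟩ := exists_sl2 (z (Sum.inl i)) (z (Sum.inr i))
      exact ⟨a, b, c, d, h1, h2, fun h => absurd h hi⟩
  choose a b c d h1 h2 h3 using key
  refine ⟨diag4 a b c d h1, ?_, fun i => a i * z (Sum.inl i) + b i * z (Sum.inr i), ?_⟩
  · intro j hj x
    obtain ⟨ha, hc⟩ := h3 j hj
    rcases x with i | i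
    · by_cases hij : i = j
      · subst hij; simp [diag4, ha]
      · simp [diag4, hij]
    · by_cases hij : i = j
      · subst hij; simp [diag4, hc]
      · simp [diag4, hij]
  · have hzz : z = Sum.elim (z ∘ Sum.inl) (z ∘ Sum.inr) := by ext (i | i) <;> rfl
    conv_lhs => rw [hzz]
    change fromBlocks _ _ _ _ *ᵥ _ = _
    rw [fromBlocks_mulVec]
    ext (i | i)
    · simp [mulVec_diagonal]
    · simp [mulVec_diagonal, h2]

theorem colOp_mulVec (b : Fin n → ℤ) (j : Fin n) (hb : b j = 0) (x : Fin n → ℤ) :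
    (colOp b j hb).1 *ᵥ Sum.elim x 0 = Sum.elim (x + x j • b) 0 := by
  change fromBlocks _ _ _ _ *ᵥ _ = _
  rw [fromBlocks_mulVec]
  ext (i | i)
  · simp [add_mulVec, vecMulVec_mulVec, mul_comm]
  · simp

theorem colOp_fixesFrom {m : ℕ} (b : Fin n → ℤ) (j : Fin n) (hb : b j = 0) (hj : (j : ℕ) < m) :
    FixesFrom m (colOp b j hb) := by
  intro k hk a
  have hkj : k ≠ j := by rintro rfl; omega
  rcases a with i | i
  · change (colOp b j hb).1.toBlocks₁₁ i k = _
    rw [colOp_toBlocks₁₁_apply, if_neg hkj, add_zero]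
    simp [one_apply]
  · change (0 : ℤ) = _
    simp

/-- Euclidean algorithm with descent on `|x k|`, touching only coordinates `≤ k`. -/
theorem exists_initial_eq_zero_of_ne_zero (k : Fin n) (m : ℕ) : ∀ x : Fin n → ℤ, x k ≠ 0 →
    (x k).natAbs = m → ∃ g : Sp n ℤ, FixesFrom (k + 1) g ∧
      ∃ y : Fin n → ℤ, g.1 *ᵥ Sum.elim x 0 = Sum.elim y 0 ∧ ∀ i < k, y i = 0 := by
  induction m using Nat.strong_induction_on with
  | _ m ih =>
  intro x hk hm
  by_cases h : ∀ i < k, x k ∣ x i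
  · refine ⟨colOp (fun i => if i < k then -(x i / x k) else 0) k (by simp),
      colOp_fixesFrom _ _ _ (Nat.lt_succ_self _), _, colOp_mulVec _ _ _ _, fun i hi => ?_⟩
    simp [hi, Int.mul_ediv_cancel' (h i hi)]
  · push Not at h
    obtain ⟨i, hi, hdiv⟩ := h
    have hik : i ≠ k := hi.ne
    have hpos : 0 < x i % x k :=
      lt_of_le_of_ne (Int.emod_nonneg _ hk) fun e => hdiv (Int.dvd_of_emod_eq_zero e.symm)
    have hlt := Int.emod_lt_abs (x i) hk
    rw [Int.abs_eq_natAbs] at hlt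
    have hmod := Int.emod_add_mul_ediv (x i) (x k)
    -- The extra `-1` turns `x i` into the remainder minus `x k`; adding this to `x k` leaves
    -- exactly the remainder in position `k`.
    let b₁ : Fin n → ℤ := Pi.single i (-(x i / x k) - 1)
    have hb₁ : b₁ k = 0 := by simp [b₁, hik.symm]
    let b₂ : Fin n → ℤ := Pi.single k 1
    have hb₂ : b₂ i = 0 := by simp [b₂, hik]
    set x' := x + x k • b₁ with hx'
    set x'' := x' + x' i • b₂ with hx''
    have hval : x'' k = x i % x k := by
      simp only [hx'', hx', b₁, b₂, Pi.add_apply, Pi.smul_apply, Pi.single_eq_same,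
        Pi.single_eq_of_ne hik.symm, smul_eq_mul]
      linear_combination -hmod
    obtain ⟨g, hg, y, hy, hy0⟩ := ih (x'' k).natAbs (by rw [hval]; omega) x''
      (by rw [hval]; exact hpos.ne') rfl
    refine ⟨g * (colOp b₂ i hb₂ * colOp b₁ k hb₁), hg.mul ((colOp_fixesFrom _ _ _ ?_).mul
      (colOp_fixesFrom _ _ _ (Nat.lt_succ_self _))), y, ?_, hy0⟩
    · have : (i : ℕ) < k := hi
      omega
    · rw [Submonoid.coe_mul, Submonoid.coe_mul, ← mulVec_mulVec, ← mulVec_mulVec, colOp_mulVec,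
        colOp_mulVec, hy]

theorem exists_initial_eq_zero (k : Fin n) (x : Fin n → ℤ) : ∃ g : Sp n ℤ, FixesFrom (k + 1) g ∧
      ∃ y : Fin n → ℤ, g.1 *ᵥ Sum.elim x 0 = Sum.elim y 0 ∧ ∀ i < k, y i = 0 := by
  by_cases hk : x k = 0
  · by_cases h : ∀ i < k, x i = 0
    · exact ⟨1, fun _ _ _ => rfl, x, one_mulVec _, h⟩
    · push Not at h
      obtain ⟨i, hi, hx⟩ := h
      have hb : (Pi.single k 1 : Fin n → ℤ) i = 0 := by simp [hi.ne]
      obtain ⟨g, hg, y, hy, hy0⟩ := exists_initial_eq_zero_of_ne_zero k _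
        (x + x i • (Pi.single k 1 : Fin n → ℤ)) (by simp [hk, hx]) rfl
      refine ⟨g * colOp _ i hb, hg.mul (colOp_fixesFrom _ _ _ ?_), y, ?_, hy0⟩
      · have : (i : ℕ) < k := hi
        omega
      · rw [Submonoid.coe_mul, ← mulVec_mulVec, colOp_mulVec, hy]
  · exact exists_initial_eq_zero_of_ne_zero k _ x hk rfl

/-- Columns are treated from the last one down. Triangularity of the upper half is what puts the
result into all standard parabolics at once. -/
theorem exists_integral_triangular (g : Sp n ℚ) (m : ℕ) (hm : m ≤ n) :
    ∃ a : Sp n ℤ, ∀ j : Fin n, m ≤ j → ∀ i : Fin n,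
      (Sp.map n (Int.castRingHom ℚ) a * g).1 (Sum.inr i) (Sum.inl j) = 0 ∧
      (i < j → (Sp.map n (Int.castRingHom ℚ) a * g).1 (Sum.inl i) (Sum.inl j) = 0) := by
  induction hm using Nat.decreasingInduction with
  | self => exact ⟨1, fun j hj => by omega⟩
  | of_succ k hk ih =>
    obtain ⟨a, ha⟩ := ih
    set h := Sp.map n (Int.castRingHom ℚ) a * g with hh
    -- The columns already treated force, by isotropy, the lower entries of index `> k` in column
    -- `k` to vanish, so the next operations may fix the upper unit vectors of these indices.
    have hpar : h ∈ parabolic ℚ (show k + 1 ≤ n from hk) :=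
      (mem_parabolic_iff _ _).2 fun j hj i => ⟨(ha j hj i).1, fun hi =>
        (ha j hj i).2 (Fin.lt_def.2 (by omega))⟩
    let k' : Fin n := ⟨k, hk⟩
    obtain ⟨⟨D, hD⟩, hDz⟩ := IsLocalization.exist_integer_multiples_of_finite (nonZeroDivisors ℤ)
      fun x => h.1 x (Sum.inl k')
    choose z hz using hDz
    simp only [algebraMap_int_eq, eq_intCast, zsmul_eq_mul] at hz
    have hD0 : (D : ℚ) ≠ 0 := by exact_mod_cast nonZeroDivisors.ne_zero hD
    obtain ⟨g₁, hg₁, x, hx⟩ := exists_lower_eq_zero (k + 1) z (fun j hj => by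
      have := hz (Sum.inr j)
      simp only [(parabolic_lower _ hpar hj k').1, mul_zero] at this
      exact_mod_cast this)
    obtain ⟨g₂, hg₂, y, hy, hy0⟩ := exists_initial_eq_zero k' x
    have hfix : FixesFrom (k + 1) (g₂ * g₁) := hg₂.mul hg₁
    have hvec : (g₂ * g₁).1 *ᵥ z = Sum.elim y 0 := by
      rw [Submonoid.coe_mul, ← mulVec_mulVec, hx, hy]
    have hcol : ∀ c, (Sp.map n (Int.castRingHom ℚ) (g₂ * g₁) * h).1 c (Sum.inl k') = 0 ↔
        Sum.elim y 0 c = 0 := by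
      intro c
      have e : (D : ℚ) * (Sp.map n (Int.castRingHom ℚ) (g₂ * g₁) * h).1 c (Sum.inl k') =
          ((Sum.elim y 0 c : ℤ) : ℚ) := by
        rw [← hvec, Submonoid.coe_mul, mul_apply, Finset.mul_sum, mulVec, dotProduct, Int.cast_sum]
        refine Finset.sum_congr rfl fun d _ => ?_
        rw [Int.cast_mul, hz d, Sp.map_apply, eq_intCast]
        ring
      rw [← Int.cast_eq_zero (α := ℚ), ← e, mul_eq_zero, or_iff_right hD0]
    refine ⟨g₂ * g₁ * a, fun j hj i => ?_⟩
    rw [map_mul, mul_assoc, ← hh]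
    rcases hj.eq_or_lt with hjk | hjk
    · have : j = k' := Fin.ext hjk.symm
      subst this
      exact ⟨(hcol _).2 rfl, fun hi => (hcol _).2 (hy0 i hi)⟩
    -- A later column is a combination of upper unit vectors of index `≥ j > k`, all of which are
    -- fixed.
    · have key : ∀ c, (Sp.map n (Int.castRingHom ℚ) (g₂ * g₁) * h).1 c (Sum.inl j) =
          h.1 c (Sum.inl j) := by
        intro c
        have e : h.1 c (Sum.inl j) =
            ∑ d, (1 : Matrix (Fin n ⊕ Fin n) (Fin n ⊕ Fin n) ℚ) c d * h.1 d (Sum.inl j) := by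
          rw [← mul_apply, one_mul]
        rw [e, Submonoid.coe_mul, mul_apply]
        refine Finset.sum_congr rfl fun d _ => ?_
        rcases d with d | d
        · by_cases hd : d < j
          · rw [(ha j hjk d).2 hd, mul_zero, mul_zero]
          · have hd' : (j : ℕ) ≤ d := not_lt.1 hd
            rw [Sp.map_apply, hfix d (by omega) c]
            congr 1
            by_cases hcd : c = Sum.inl d
            · subst hcd; simp
            · simp [one_apply_ne hcd]
        · rw [(ha j hjk d).1, mul_zero, mul_zero]
      rw [key, key]
      exact ha j hjk i

/-- Every rational symplectic matrix is a product of an integral one and one that is contained in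
all standard parabolic subgroups. -/
theorem exists_integral_mul (g : Sp n ℚ) : ∃ (a : Sp n ℤ) (b : Sp n ℚ),
    g = Sp.map n (Int.castRingHom ℚ) a * b ∧ ∀ t (ht : t ≤ n), b ∈ parabolic ℚ ht := by
  obtain ⟨a, ha⟩ := exists_integral_triangular g 0 (Nat.zero_le n)
  refine ⟨a⁻¹, Sp.map n (Int.castRingHom ℚ) a * g, by rw [map_inv, inv_mul_cancel_left],
    fun t ht => (mem_parabolic_iff _ _).2 fun j hj i => ⟨(ha j (Nat.zero_le _) i).1, fun hi =>
      (ha j (Nat.zero_le _) i).2 (Fin.lt_def.2 (by omega))⟩⟩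

end Integral

/-! ### Cusps, double cosets and inclusions -/

section Geometry

variable {s r t n : ℕ}

theorem HStar.extend_smul (h : r ≤ n) {p : Sp n ℚ} (hp : p ∈ parabolic ℚ h) (W : HStar r) :
    p • W.extend h = (omega ℚ h ⟨p, hp⟩ • W).extend h :=
  Subtype.ext (extend_act h ⟨p, hp⟩ W.1).symm

theorem HStar.xi_smul_extend (h : r ≤ n) (g : Sp r ℚ) (W : HStar r) :
    xi h g • W.extend h = (g • W).extend h := by
  rw [HStar.extend_smul h (xi_mem h g), omega_xi]

theorem HStar.extend_extend (hs : s ≤ r) (hr : r ≤ n) (W : HStar s) :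
    (W.extend hs).extend hr = W.extend (hs.trans hr) := by
  have e : ∀ i : Fin s, split hr (Sum.inl (split hs (Sum.inl i))) =
      split (hs.trans hr) (Sum.inl i) := fun i => Fin.ext (by simp [split_inl_val])
  have e' : ((Sum.map (split hr ∘ Sum.inl) (split hr ∘ Sum.inl) : Fin r ⊕ Fin r → Fin n ⊕ Fin n) ∘
      (Sum.map (split hs ∘ Sum.inl) (split hs ∘ Sum.inl) : Fin s ⊕ Fin s → Fin r ⊕ Fin r)) =
      Sum.map (split (hs.trans hr) ∘ Sum.inl) (split (hs.trans hr) ∘ Sum.inl) := by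
    ext (i | i) : 1 <;> simp [e]
  apply Subtype.ext
  ext v
  constructor
  · rintro ⟨⟨h1, h2⟩, h3⟩
    refine ⟨by rwa [Function.comp_assoc, e'] at h1, fun i => ?_⟩
    have hi := split_inr_val (hs.trans hr) i
    by_cases hir : (split (hs.trans hr) (Sum.inr i) : ℕ) < r
    · obtain ⟨k, hk⟩ := exists_split_inl hr hir
      have hk' := congrArg Fin.val hk
      rw [split_inl_val] at hk'
      obtain ⟨l, rfl⟩ := exists_split_inr hs (i := k) (by omega)
      rw [hk]
      exact h2 l
    · obtain ⟨k, hk⟩ := exists_split_inr hr (not_lt.1 hir)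
      rw [hk]
      exact h3 k
  · rintro ⟨h1, h2⟩
    refine ⟨⟨by rwa [Function.comp_assoc, e'], fun i => ?_⟩, fun i => ?_⟩
    · obtain ⟨k, hk⟩ := exists_split_inr (hs.trans hr) (i := split hr (Sum.inl (split hs (Sum.inr i))))
        (by rw [split_inl_val, split_inr_val]; omega)
      simp only [Function.comp_apply, Sum.map_inr, hk]
      exact h2 k
    · obtain ⟨k, hk⟩ := exists_split_inr (hs.trans hr) (i := split hr (Sum.inr i))
        (by rw [split_inr_val]; omega)
      rw [hk]
      exact h2 k

theorem mem_cusp_iff (h : r ≤ n) (Γ : Subgroup (Sp n ℚ)) (γ : Sp n ℚ) (x : Satake Γ) :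
    x ∈ cusp h Γ γ ↔ ∃ W : HStar r, (Quotient.mk'' (γ • W.extend h) : Satake Γ) = x := by
  constructor
  · rintro ⟨y, rfl⟩
    induction y using Quotient.inductionOn' with
    | h W => exact ⟨W, rfl⟩
  · rintro ⟨W, rfl⟩
    exact ⟨Quotient.mk'' W, rfl⟩

theorem cusp_mul_subset (h : r ≤ n) {Γ : Subgroup (Sp n ℚ)} {d q : Sp n ℚ} (γ : Sp n ℚ)
    (hd : d ∈ Γ) (hq : q ∈ parabolic ℚ h) : cusp h Γ (d * γ * q) ⊆ cusp h Γ γ := by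
  intro x hx
  rw [mem_cusp_iff] at hx ⊢
  obtain ⟨W, rfl⟩ := hx
  refine ⟨omega ℚ h ⟨q, hq⟩ • W, ?_⟩
  rw [← HStar.extend_smul h hq]
  symm
  apply Quotient.sound'
  refine ⟨⟨d, hd⟩, ?_⟩
  change d • γ • q • W.extend h = (d * γ * q) • W.extend h
  rw [smul_smul, smul_smul, mul_assoc]

theorem cusp_mul (h : r ≤ n) {Γ : Subgroup (Sp n ℚ)} {d q : Sp n ℚ} (γ : Sp n ℚ)
    (hd : d ∈ Γ) (hq : q ∈ parabolic ℚ h) : cusp h Γ (d * γ * q) = cusp h Γ γ := by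
  refine (cusp_mul_subset h γ hd hq).antisymm ?_
  have := cusp_mul_subset h (d * γ * q) (inv_mem hd) (inv_mem hq)
  rwa [show d⁻¹ * (d * γ * q) * q⁻¹ = γ by group] at this

theorem cusp_subset_cusp (hs : s ≤ r) (hr : r ≤ n) (Γ : Subgroup (Sp n ℚ)) (γ : Sp n ℚ) :
    cusp (hs.trans hr) Γ γ ⊆ cusp hr Γ γ := by
  intro x hx
  rw [mem_cusp_iff] at hx ⊢
  obtain ⟨W, rfl⟩ := hx
  exact ⟨W.extend hs, by rw [HStar.extend_extend]⟩

/-- Translates self-intersection of an `r`-cusp into an equality of `s`-cusps of the full space. -/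
theorem image_boundaryMap_cusp (hs : s ≤ r) (hr : r ≤ n) (Γ : Subgroup (Sp n ℚ)) (γ : Sp n ℚ)
    (ρ : Sp r ℚ) : boundaryMap hr Γ γ '' cusp hs (boundaryGroup hr Γ γ) ρ =
      cusp (hs.trans hr) Γ (γ * xi hr ρ) := by
  have key : ∀ W : HStar s, boundaryMap hr Γ γ (Quotient.mk'' (ρ • W.extend hs)) =
      Quotient.mk'' ((γ * xi hr ρ) • W.extend (hs.trans hr)) := by
    intro W
    rw [mul_smul, ← HStar.extend_extend hs hr, HStar.xi_smul_extend]
    rfl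
  ext x
  rw [mem_cusp_iff]
  constructor
  · rintro ⟨y, hy, rfl⟩
    obtain ⟨W, rfl⟩ := (mem_cusp_iff _ _ _ _).1 hy
    exact ⟨W, (key W).symm⟩
  · rintro ⟨W, rfl⟩
    exact ⟨_, (mem_cusp_iff _ _ _ _).2 ⟨W, rfl⟩, key W⟩

/-- The point `i · 1` of the upper half space. -/
noncomputable def basePoint (r : ℕ) : UpperHalfSpace r :=
  ⟨Complex.I • 1, by simp, by
    have : ((Complex.I • 1 : Matrix (Fin r) (Fin r) ℂ).map Complex.im) = 1 := by
      ext i j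
      by_cases h : i = j
      · subst h; simp
      · simp [one_apply_ne h]
    rw [this]
    exact PosDef.one⟩

theorem basePoint_inv (r : ℕ) : (basePoint r).1⁻¹ = -Complex.I • (1 : Matrix (Fin r) (Fin r) ℂ) := by
  apply inv_eq_right_inv
  change (Complex.I • 1 : Matrix (Fin r) (Fin r) ℂ) * _ = 1
  rw [smul_mul_smul_comm]
  simp

/-- For `Z = i` the first `r` lower coordinates are `-i` times the upper ones, and rational numbers
with such a relation vanish. The point thus remembers the rational subspace defining its boundary
component. -/
theorem rational_mem_jPoint (h : r ≤ n) {v : Fin n ⊕ Fin n → ℚ}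
    (hv : (fun i => (v i : ℂ)) ∈ jPoint h (basePoint r)) (i : Fin n) :
    v (Sum.inr i) = 0 ∧ ((i : ℕ) < r → v (Sum.inl i) = 0) := by
  rw [mem_jPoint, basePoint_inv] at hv
  have hi := congrFun hv i
  simp only [Function.comp_apply, mulVec, dotProduct, pad_apply] at hi
  by_cases hir : (i : ℕ) < r
  · rw [Finset.sum_eq_single i] at hi
    · simp only [hir, and_self, dite_true, Matrix.smul_apply, one_apply_eq, smul_eq_mul,
        mul_one] at hi
      have h1 := congrArg Complex.re hi
      have h2 := congrArg Complex.im hi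
      simp at h1 h2
      exact ⟨h1, fun _ => h2⟩
    · intro k _ hk
      split_ifs with h2
      · rw [Matrix.smul_apply, one_apply_ne (by
          intro e
          exact hk (Fin.ext (congrArg Fin.val e).symm)), smul_zero, zero_mul]
      · rw [zero_mul]
    · simp
  · simp only [hir, false_and, dite_false, zero_mul, Finset.sum_const_zero] at hi
    exact ⟨by exact_mod_cast hi, fun h => absurd h hir⟩

theorem single_mem_extend (h : t ≤ n) (W : Submodule ℂ (Fin t ⊕ Fin t → ℂ)) {j : Fin n}
    (hj : t ≤ j) : (Pi.single (Sum.inl j) 1 : Fin n ⊕ Fin n → ℂ) ∈ extend h W := by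
  constructor
  · convert W.zero_mem using 1
    ext (i | i)
    · have : split h (Sum.inl i) ≠ j := fun e => by
        have := congrArg Fin.val e
        rw [split_inl_val] at this
        omega
      simp [this]
    · simp
  · simp

/-- The base point of the smaller cusp equals, up to `Γ`, a point of the larger one. The latter
contains the upper unit vectors of index `≥ t`, whose images are rational vectors in the space of
the base point. -/
theorem exists_of_cusp_subset (hr : r ≤ n) (ht : t ≤ n) {Γ : Subgroup (Sp n ℚ)} {γ γ' : Sp n ℚ}
    (h : cusp hr Γ γ ⊆ cusp ht Γ γ') : ∃ d ∈ Γ, ColSupp t r (γ⁻¹ * d * γ').1 := by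
  let W : HStar r := ⟨jPoint le_rfl (basePoint r), r, le_rfl, 1, basePoint r, (act_one _).symm⟩
  obtain ⟨W', hW'⟩ := (mem_cusp_iff _ _ _ _).1 (h ((mem_cusp_iff _ _ _ _).2 ⟨W, rfl⟩))
  obtain ⟨⟨d, hd⟩, hdW⟩ := Quotient.exact' hW'
  change d • γ • W.extend hr = γ' • W'.extend ht at hdW
  have h1 : (γ⁻¹ * d⁻¹ * γ') • W'.extend ht = W.extend hr := by
    rw [mul_smul, ← hdW, smul_smul, smul_smul, show γ⁻¹ * d⁻¹ * d * γ = 1 by group, one_smul]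
  refine ⟨d⁻¹, inv_mem hd, fun j hj i => ?_⟩
  have h2 : act (γ⁻¹ * d⁻¹ * γ') (extend ht W'.1) = jPoint hr (basePoint r) := by
    rw [← extend_jPoint le_rfl hr]
    exact congrArg Subtype.val h1
  have h3 := Submodule.mem_map_of_mem (f := ((γ⁻¹ * d⁻¹ * γ').1.map (algebraMap ℚ ℂ)).mulVecLin)
    (single_mem_extend ht W'.1 hj)
  change _ ∈ act (γ⁻¹ * d⁻¹ * γ') (extend ht W'.1) at h3
  rw [h2] at h3
  refine rational_mem_jPoint hr (v := fun a => (γ⁻¹ * d⁻¹ * γ').1 a (Sum.inl j)) ?_ i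
  generalize γ⁻¹ * d⁻¹ * γ' = M at h3 ⊢
  convert h3 using 1
  ext a
  simp

end Geometry

/-! ### Reduction of the representatives modulo primes -/

section Reps

variable {r n : ℕ} {R S : Type*} [CommRing R] [CommRing S]

theorem pad_map (h : r ≤ n) (f : R →+* S) (M : Matrix (Fin r) (Fin r) R)
    (D : Matrix (Fin (n - r)) (Fin (n - r)) R) : (pad h M D).map f = pad h (M.map f) (D.map f) := by
  rw [pad, pad, ← submatrix_map, fromBlocks_map, Matrix.map_zero f (map_zero f),
    Matrix.map_zero f (map_zero f)]

theorem map_xi (h : r ≤ n) (f : R →+* S) (g : Sp r R) :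
    Sp.map n f (xi h g) = xi h (Sp.map r f g) := by
  apply Subtype.ext
  change (fromBlocks _ _ _ _).map f = fromBlocks _ _ _ _
  simp only [fromBlocks_map, pad_map, Matrix.map_zero f (map_zero f),
    Matrix.map_one f (map_zero f) (map_one f)]
  rfl

theorem xi_one (h : r ≤ n) : xi h (1 : Sp r R) = 1 := by
  have e : (1 : Sp r R).1 = fromBlocks 1 0 0 1 := fromBlocks_one.symm
  have e0 : pad h (0 : Matrix (Fin r) (Fin r) R) 0 = 0 := by simp [pad]
  apply Subtype.ext
  change fromBlocks (pad h (1 : Sp r R).1.toBlocks₁₁ 1) (pad h (1 : Sp r R).1.toBlocks₁₂ 0)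
    (pad h (1 : Sp r R).1.toBlocks₂₁ 0) (pad h (1 : Sp r R).1.toBlocks₂₂ 1) = _
  rw [e, toBlocks_fromBlocks₁₁, toBlocks_fromBlocks₁₂, toBlocks_fromBlocks₂₁,
    toBlocks_fromBlocks₂₂, pad_one, e0, fromBlocks_one]
  rfl

/-- The indices in `[a, b)`. -/
def seg (n a b : ℕ) : Finset (Fin n) := tail n a \ tail n b

theorem mem_seg {a b : ℕ} {i : Fin n} : i ∈ seg n a b ↔ a ≤ (i : ℕ) ∧ (i : ℕ) < b := by
  rw [seg, Finset.mem_sdiff, mem_tail, mem_tail, not_le]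

theorem card_seg_inter_tail {a b : ℕ} (hb : b ≤ n) (t : ℕ) :
    (seg n a b ∩ tail n t).card = b - max a t := by
  have h : (seg n a b ∩ tail n t).map Fin.valEmbedding = Finset.Ico (max a t) b := by
    ext i
    simp only [Finset.mem_map, Finset.mem_inter, mem_seg, mem_tail, Fin.valEmbedding_apply,
      Finset.mem_Ico]
    exact ⟨fun ⟨a, h, e⟩ => by omega, fun h => ⟨⟨i, by omega⟩, by simp only; omega, rfl⟩⟩
  rw [← Finset.card_map, h, Nat.card_Ico]

theorem pad_scalar (h : r ≤ n) (x y : R) :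
    pad h (diagonal fun _ => x) (diagonal fun _ => y) =
      diagonal fun i => if i ∈ seg n 0 r then x else y := by
  rw [pad, fromBlocks_diagonal, submatrix_diagonal_equiv]
  congr 1
  ext i
  obtain ⟨i, rfl⟩ := (split h).surjective i
  cases i with
  | inl i => simp [mem_seg, split_inl_val]
  | inr i => simp [mem_seg, split_inr_val]

theorem xi_eq_weyl (h : r ≤ n) {g : Sp r R} (hg : g.1 = J (Fin r) R) :
    xi h g = weyl R (seg n 0 r) := by
  have h1 : (1 : Matrix (Fin r) (Fin r) R) = diagonal fun _ => 1 := diagonal_one.symm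
  have h0 : (0 : Matrix (Fin r) (Fin r) R) = diagonal fun _ => 0 := diagonal_zero.symm
  have h2 : (-1 : Matrix (Fin r) (Fin r) R) = diagonal fun _ => -1 := by
    rw [h1, diagonal_neg]
  have h3 : (1 : Matrix (Fin (n - r)) (Fin (n - r)) R) = diagonal fun _ => 1 := diagonal_one.symm
  have h4 : (0 : Matrix (Fin (n - r)) (Fin (n - r)) R) = diagonal fun _ => 0 := diagonal_zero.symm
  have e1 : pad h (0 : Matrix (Fin r) (Fin r) R) 1 = 1 - ind R (seg n 0 r) := by
    rw [h0, h3, pad_scalar, ind, ← diagonal_one, diagonal_sub]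
    congr 1
    ext i
    split_ifs <;> simp
  have e2 : pad h (-1 : Matrix (Fin r) (Fin r) R) 0 = -ind R (seg n 0 r) := by
    rw [h2, h4, pad_scalar, ind, diagonal_neg]
    congr 1
    ext i
    split_ifs <;> simp
  have e3 : pad h (1 : Matrix (Fin r) (Fin r) R) 0 = ind R (seg n 0 r) := by
    rw [h1, h4, pad_scalar, ind]
  apply Subtype.ext
  change fromBlocks _ _ _ _ = fromBlocks _ _ _ _
  rw [hg, J]
  simp only [toBlocks_fromBlocks₁₁, toBlocks_fromBlocks₁₂, toBlocks_fromBlocks₂₁,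
    toBlocks_fromBlocks₂₂, e1, e2, e3]

/-- By coprimality at most one factor of a cusp representative is nontrivial modulo a given prime.
-/
theorem prod_map_eq_of_nodup {ι M : Type*} [Monoid M] (L : List ι) (hL : L.Nodup) (f : ι → M)
    {i : ι} (hi : i ∈ L) (h : ∀ j, j ≠ i → f j = 1) : (L.map f).prod = f i := by
  induction L with
  | nil => exact absurd hi List.not_mem_nil
  | cons a L ih =>
    rw [List.nodup_cons] at hL
    rw [List.map_cons, List.prod_cons]
    by_cases ha : a = i
    · subst ha
      rw [List.prod_eq_one, mul_one]
      intro x hx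
      obtain ⟨j, hj, rfl⟩ := List.mem_map.1 hx
      exact h j (fun e => hL.1 (e ▸ hj))
    · rw [h a ha, one_mul]
      exact ih hL.2 ((List.mem_cons.1 hi).resolve_left (Ne.symm ha))

/-- The integral matrix underlying `cuspRep`. -/
def intCuspRep (g : ∀ m : ℕ, ℕ → Sp m ℤ) {r n : ℕ} (l : Fin (n - r) → ℕ) : Sp n ℤ :=
  ((List.finRange (n - r)).reverse.map fun i : Fin (n - r) =>
    xi (show r + (i + 1) ≤ n by omega) (g (r + (i + 1)) (l i))).prod

theorem map_intCuspRep (g : ∀ m : ℕ, ℕ → Sp m ℤ) {r n : ℕ} (l : Fin (n - r) → ℕ) :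
    Sp.map n (Int.castRingHom ℚ) (intCuspRep g l) = cuspRep g l := by
  rw [intCuspRep, cuspRep, map_list_prod, List.map_map, List.ofFn_eq_map, ← List.map_reverse]
  congr 2
  ext i : 1
  exact map_xi _ _ _

theorem red_basicRep_of_dvd {m N l p : ℕ} {g : Sp m ℤ} (hg : IsBasicRep m N l g) (hp : p ∣ l) :
    (red m p g).1 = J (Fin m) (ZMod p) := by
  have hd : p ∣ l ^ 2 := dvd_pow hp two_ne_zero
  rw [← map_J _ (ZMod.castHom hd (ZMod p)), ← hg.1]
  ext i j
  simp [Sp.map_apply]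

theorem red_basicRep_of_dvd_div {m N l p : ℕ} {g : Sp m ℤ} (hg : IsBasicRep m N l g)
    (hp : p ∣ N / l) : red m p g = 1 := by
  have hd : p ∣ (N / l) ^ 2 := dvd_pow hp two_ne_zero
  rw [← map_one (Sp.map m (ZMod.castHom hd (ZMod p))), ← hg.2]
  apply Subtype.ext
  ext i j
  simp [Sp.map_apply]

end Reps

/-! ### Ranks at the primes dividing the level -/

section RankAt

variable {n : ℕ}

open Classical in
/-- The rank of the lower half of the last `n - t` columns of the left half of `g` modulo `p`. -/
noncomputable def rankAt (p : ℕ) (g : Sp n ℤ) (t : ℕ) : ℕ :=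
  if hp : p.Prime then
    have : Fact p.Prime := ⟨hp⟩
    lowerRank (red n p g) t
  else 0

theorem rankAt_eq (p : ℕ) [hp : Fact p.Prime] (g : Sp n ℤ) (t : ℕ) :
    rankAt p g t = lowerRank (red n p g) t := by
  rw [rankAt, dif_pos hp.out]

theorem rankAt_le (p : ℕ) (g : Sp n ℤ) (t : ℕ) : rankAt p g t ≤ n - t := by
  by_cases hp : p.Prime
  · have : Fact p.Prime := ⟨hp⟩
    rw [rankAt_eq]
    exact lowerRank_le _ _
  · rw [rankAt, dif_neg hp]
    exact Nat.zero_le _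

/-- With `d` from the inclusion, `b = d⁻¹ * a * (a⁻¹ * d * b)`: all factors are integral, `d⁻¹` is
Siegel modulo `p`, and the support condition on the last factor survives reduction. -/
theorem rankAt_of_cusp_subset {N s t : ℕ} (hN : Squarefree N) (hs : s ≤ n) (ht : t ≤ n)
    (hst : s ≤ t) {a b : Sp n ℤ}
    (h : cusp hs (Gamma0 n N) (Sp.map n (Int.castRingHom ℚ) a) ⊆
      cusp ht (Gamma0 n N) (Sp.map n (Int.castRingHom ℚ) b)) {p : ℕ} (hp : p ∈ N.primeFactors) :
    rankAt p b t ≤ rankAt p a s ∧ rankAt p a s ≤ rankAt p b t + (t - s) := by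
  have : Fact p.Prime := ⟨Nat.prime_of_mem_primeFactors hp⟩
  obtain ⟨d, hd, hc⟩ := exists_of_cusp_subset hs ht h
  obtain ⟨d, rfl⟩ := exists_map_of_mem_Gamma0 hd
  rw [← map_inv, ← map_mul, ← map_mul] at hc
  have hc' := hc.of_map (RingHom.injective_int (Int.castRingHom ℚ))
  have hd' := (map_mem_Gamma0_iff hN d).1 hd p hp
  have := lowerRank_mul (inv_mem hd') (red n p a) (hc'.map (Int.castRingHom (ZMod p))) hst ht
  rw [← map_inv, ← map_mul, ← map_mul,
    show d⁻¹ * a * (a⁻¹ * d * b) = b by group] at this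
  rwa [rankAt_eq, rankAt_eq]

theorem exists_of_rankAt_eq {N r s : ℕ} (hN : Squarefree N) (hr : r ≤ n) (hs : s ≤ n)
    (hsr : s ≤ r) (a b : Sp n ℤ) (h₁ : ∀ p ∈ N.primeFactors, rankAt p a r = rankAt p b r)
    (h₂ : ∀ p ∈ N.primeFactors, rankAt p a s = rankAt p b s) :
    ∃ d ∈ Gamma0 n N, ∃ q : Sp n ℚ, q ∈ parabolic ℚ hr ∧ q ∈ parabolic ℚ hs ∧
      Sp.map n (Int.castRingHom ℚ) b = d * Sp.map n (Int.castRingHom ℚ) a * q := by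
  obtain ⟨d, hd, q, hq, rfl⟩ := exists_of_lowerRank_eq hN hr hs hsr a b
    (fun p hp _ => by rw [← rankAt_eq, ← rankAt_eq, h₁ p hp])
    (fun p hp _ => by rw [← rankAt_eq, ← rankAt_eq, h₂ p hp])
  exact ⟨_, hd, _, map_mem_parabolic hr _ hq.1, map_mem_parabolic hs _ hq.2, by
    rw [map_mul, map_mul]⟩

theorem cusp_eq_of_rankAt_eq {N r : ℕ} (hN : Squarefree N) (hr : r ≤ n) (a b : Sp n ℤ)
    (h : ∀ p ∈ N.primeFactors, rankAt p a r = rankAt p b r) :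
    cusp hr (Gamma0 n N) (Sp.map n (Int.castRingHom ℚ) a) =
      cusp hr (Gamma0 n N) (Sp.map n (Int.castRingHom ℚ) b) := by
  obtain ⟨d, hd, q, hq, -, e⟩ := exists_of_rankAt_eq hN hr hr le_rfl a b h h
  rw [e, cusp_mul hr _ hd hq]

theorem rankAt_of_red_eq_weyl {p : ℕ} (hp : p.Prime) {g : Sp n ℤ} {I : Finset (Fin n)}
    (h : red n p g = weyl (ZMod p) I) (t : ℕ) : rankAt p g t = (I ∩ tail n t).card := by
  have : Fact p.Prime := ⟨hp⟩
  rw [rankAt_eq, h, lowerRank_weyl]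

theorem weyl_empty {R : Type*} [CommRing R] : weyl R (∅ : Finset (Fin n)) = 1 := by
  apply Subtype.ext
  change fromBlocks _ _ _ _ = _
  simp [ind]

/-- The prime `p` divides the entry `i` of a tuple exactly when the rank at `p` of the
representative of the tuple is `i + 1`. -/
theorem dvd_iff_rankAt {N : ℕ} (g : ∀ m : ℕ, ℕ → Sp m ℤ)
    (hg : ∀ m l : ℕ, 1 ≤ m → m ≤ n → l ∣ N → IsBasicRep m N l (g m l)) {r : ℕ}
    {l : Fin (n - r) → ℕ} (hl : IsCuspTuple N l) {p : ℕ} (hp : p ∈ N.primeFactors)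
    (i : Fin (n - r)) : p ∣ l i ↔ rankAt p (intCuspRep g l) r = i + 1 := by
  have hpp := Nat.prime_of_mem_primeFactors hp
  have hpN := Nat.dvd_of_mem_primeFactors hp
  have h1 : ∀ j, ¬ p ∣ l j → red n p (xi (show r + (j + 1) ≤ n by omega)
      (g (r + (j + 1)) (l j))) = 1 := by
    intro j hj
    rw [map_xi, red_basicRep_of_dvd_div (hg _ _ (by omega) (by omega) (hl.1 j).2), xi_one]
    refine (hpp.dvd_mul.1 ?_).resolve_left hj
    rwa [Nat.mul_div_cancel' (hl.1 j).2]
  have h2 : ∀ j, p ∣ l j → rankAt p (intCuspRep g l) r = j + 1 := by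
    intro j hj
    -- Only the factor of index `j` survives, and `[0, r + j + 1)` has `j + 1` elements that are `≥
    -- r`.
    rw [rankAt_of_red_eq_weyl hpp (I := seg n 0 (r + (j + 1))), card_seg_inter_tail (by omega)]
    · omega
    · rw [intCuspRep, map_list_prod, List.map_map,
        prod_map_eq_of_nodup _ (List.nodup_reverse.2 (List.nodup_finRange _)) _
          (List.mem_reverse.2 (List.mem_finRange j))]
      · exact (map_xi _ _ _).trans (xi_eq_weyl _
          (red_basicRep_of_dvd (hg _ _ (by omega) (by omega) (hl.1 j).2) hj))
      · intro k hk
        exact h1 k fun hk' => hpp.one_lt.ne' (Nat.dvd_one.1 ((hl.2 hk) ▸ Nat.dvd_gcd hk' hj))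
  refine ⟨h2 i, fun h => ?_⟩
  by_cases hex : ∃ j, p ∣ l j
  · obtain ⟨j, hj⟩ := hex
    have := h2 j hj
    rw [h] at this
    rwa [show i = j from Fin.ext (by omega)]
  · push Not at hex
    have : rankAt p (intCuspRep g l) r = 0 := by
      rw [rankAt_of_red_eq_weyl hpp (I := ∅), Finset.empty_inter, Finset.card_empty]
      rw [weyl_empty, intCuspRep, map_list_prod, List.map_map]
      refine List.prod_eq_one fun x hx => ?_
      obtain ⟨j, -, rfl⟩ := List.mem_map.1 hx
      exact h1 j (hex j)
    omega

end RankAt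

/-! ### Classification of cusps and self-intersection -/

section Main

variable {n : ℕ}

/-- The value `0` matches no entry of a tuple, but is the only value left over. -/
theorem eq_of_forall_eq_succ_iff {k x y : ℕ} (hx : x ≤ k) (hy : y ≤ k)
    (h : ∀ i : Fin k, x = i + 1 ↔ y = i + 1) : x = y := by
  rcases Nat.eq_zero_or_pos x with rfl | hx0
  · rcases Nat.eq_zero_or_pos y with rfl | hy0
    · rfl
    · have := (h ⟨y - 1, by omega⟩).2 (by simp only; omega)
      simp only at this
      omega
  · have := (h ⟨x - 1, by omega⟩).1 (by simp only; omega)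
    simp only at this
    omega

theorem eq_of_forall_prime_dvd_iff {N a b : ℕ} (hN : N ≠ 0) (ha : Squarefree a) (hb : Squarefree b)
    (haN : a ∣ N) (hbN : b ∣ N) (h : ∀ p ∈ N.primeFactors, p ∣ a ↔ p ∣ b) : a = b := by
  rw [Nat.Squarefree.ext_iff ha hb]
  intro p hp
  by_cases hpN : p ∣ N
  · exact h p (Nat.mem_primeFactors.2 ⟨hp, hpN, hN⟩)
  · exact ⟨fun h => absurd (h.trans haN) hpN, fun h => absurd (h.trans hbN) hpN⟩

theorem cuspTuple_injective {N : ℕ} (hN : Squarefree N) (g : ∀ m : ℕ, ℕ → Sp m ℤ)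
    (hg : ∀ m l : ℕ, 1 ≤ m → m ≤ n → l ∣ N → IsBasicRep m N l (g m l)) {r : ℕ} (hr : r ≤ n)
    {l l' : Fin (n - r) → ℕ} (hl : IsCuspTuple N l) (hl' : IsCuspTuple N l')
    (h : cusp hr (Gamma0 n N) (cuspRep g l) = cusp hr (Gamma0 n N) (cuspRep g l')) : l = l' := by
  rw [← map_intCuspRep, ← map_intCuspRep] at h
  ext i
  refine eq_of_forall_prime_dvd_iff hN.ne_zero (hN.squarefree_of_dvd (hl.1 i).2)
    (hN.squarefree_of_dvd (hl'.1 i).2) (hl.1 i).2 (hl'.1 i).2 fun p hp => ?_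
  have h1 := rankAt_of_cusp_subset hN hr hr le_rfl h.subset hp
  rw [dvd_iff_rankAt g hg hl hp, dvd_iff_rankAt g hg hl' hp]
  omega

theorem exists_cuspTuple {N : ℕ} (hN : Squarefree N) (g : ∀ m : ℕ, ℕ → Sp m ℤ)
    (hg : ∀ m l : ℕ, 1 ≤ m → m ≤ n → l ∣ N → IsBasicRep m N l (g m l)) {r : ℕ} (hr : r ≤ n)
    (γ : Sp n ℚ) : ∃ l : Fin (n - r) → ℕ, IsCuspTuple N l ∧
      cusp hr (Gamma0 n N) (cuspRep g l) = cusp hr (Gamma0 n N) γ := by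
  obtain ⟨a, b, rfl, hb⟩ := exists_integral_mul γ
  -- Primes are sorted by their rank; those of rank `0` enter no entry.
  let l : Fin (n - r) → ℕ := fun i => ∏ p ∈ N.primeFactors with rankAt p a r = i + 1, p
  have hdvd : ∀ p : ℕ, p.Prime → ∀ i, p ∣ l i ↔ p ∈ N.primeFactors ∧ rankAt p a r = i + 1 := by
    intro p hp i
    simp only [l]
    rw [hp.prime.dvd_finsetProd_iff]
    constructor
    · rintro ⟨q, hq, hpq⟩
      rw [Finset.mem_filter] at hq
      rwa [(Nat.prime_dvd_prime_iff_eq hp (Nat.prime_of_mem_primeFactors hq.1)).1 hpq]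
    · intro h
      exact ⟨p, Finset.mem_filter.2 h, dvd_rfl⟩
  have hl : IsCuspTuple N l := by
    refine ⟨fun i => ⟨?_, ?_⟩, fun i j hij => ?_⟩
    · exact Finset.prod_pos fun p hp =>
        (Nat.prime_of_mem_primeFactors (Finset.mem_filter.1 hp).1).pos
    · conv_rhs => rw [← Nat.prod_primeFactors_of_squarefree hN]
      exact Finset.prod_dvd_prod_of_subset _ _ _ (Finset.filter_subset _ _)
    · refine Nat.Coprime.symm (Nat.coprime_of_dvd fun p hp h1 h2 => hij (Fin.ext ?_))
      have e1 := ((hdvd p hp _).1 h1).2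
      have e2 := ((hdvd p hp _).1 h2).2
      omega
  refine ⟨l, hl, ?_⟩
  have e := cusp_mul hr (Γ := Gamma0 n N) (Sp.map n (Int.castRingHom ℚ) a) (one_mem _) (hb r hr)
  rw [one_mul] at e
  rw [e, ← map_intCuspRep]
  refine cusp_eq_of_rankAt_eq hN hr _ _ fun p hp =>
    eq_of_forall_eq_succ_iff (rankAt_le _ _ _) (rankAt_le _ _ _) fun i => ?_
  rw [← dvd_iff_rankAt g hg hl hp, hdvd p (Nat.prime_of_mem_primeFactors hp)]
  exact and_iff_right hp

theorem omega_mem_parabolic {r s : ℕ} (hs : s ≤ r) (hr : r ≤ n) (p : parabolic ℚ hr)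
    (hp : p.1 ∈ parabolic ℚ (hs.trans hr)) : omega ℚ hr p ∈ parabolic ℚ hs := by
  rw [mem_parabolic_iff] at hp ⊢
  intro j hj i
  have h := hp (split hr (Sum.inl j)) (by rwa [split_inl_val]) (split hr (Sum.inl i))
  rw [split_inl_val] at h
  exact h

/-- The ranks agree at `s` by hypothesis and at `r` because `ξ(ρ)` and `ξ(ρ')` lie in `P_{n,r}`. The
correcting element can therefore be chosen in `P_{n,r} ∩ P_{n,s}`, so that `ω` applies to the whole
relation. -/
theorem cusp_eq_of_image_eq {N r s : ℕ} (hN : Squarefree N) (hs : s ≤ r) (hr : r ≤ n)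
    (γ : Sp n ℚ) (ρ ρ' : Sp r ℚ)
    (h : cusp (hs.trans hr) (Gamma0 n N) (γ * xi hr ρ) =
      cusp (hs.trans hr) (Gamma0 n N) (γ * xi hr ρ')) :
    cusp hs (boundaryGroup hr (Gamma0 n N) γ) ρ = cusp hs (boundaryGroup hr (Gamma0 n N) γ) ρ' := by
  have h' : cusp hr (Gamma0 n N) (γ * xi hr ρ) = cusp hr (Gamma0 n N) (γ * xi hr ρ') := by
    have key : ∀ ρ, cusp hr (Gamma0 n N) (γ * xi hr ρ) = cusp hr (Gamma0 n N) γ := fun ρ => by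
      have := cusp_mul hr (Γ := Gamma0 n N) γ (one_mem _) (xi_mem hr ρ)
      rwa [one_mul] at this
    rw [key, key]
  obtain ⟨a, b, e, hb⟩ := exists_integral_mul (γ * xi hr ρ)
  obtain ⟨a', b', e', hb'⟩ := exists_integral_mul (γ * xi hr ρ')
  have key : ∀ t (ht : t ≤ n),
      cusp ht (Gamma0 n N) (γ * xi hr ρ) = cusp ht (Gamma0 n N) (γ * xi hr ρ') →
      ∀ p ∈ N.primeFactors, rankAt p a t = rankAt p a' t := by
    intro t ht h p hp
    have c1 := cusp_mul ht (Γ := Gamma0 n N) (Sp.map n (Int.castRingHom ℚ) a) (one_mem _) (hb t ht)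
    have c2 := cusp_mul ht (Γ := Gamma0 n N) (Sp.map n (Int.castRingHom ℚ) a') (one_mem _)
      (hb' t ht)
    rw [one_mul, ← e] at c1
    rw [one_mul, ← e'] at c2
    rw [c1, c2] at h
    have := rankAt_of_cusp_subset hN ht ht le_rfl h.subset hp
    omega
  obtain ⟨d, hd, q, hq, hq', e''⟩ := exists_of_rankAt_eq hN hr (hs.trans hr) hs a a'
    (key r hr h') (key s _ h)
  have hx : b⁻¹ * q * b' ∈ parabolic ℚ hr :=
    mul_mem (mul_mem (inv_mem (hb _ _)) hq) (hb' _ _)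
  have hx' : b⁻¹ * q * b' ∈ parabolic ℚ (hs.trans hr) :=
    mul_mem (mul_mem (inv_mem (hb _ _)) hq') (hb' _ _)
  have e3 : γ * xi hr ρ' = d * (γ * xi hr ρ) * (b⁻¹ * q * b') := by
    rw [e', e'', e]
    group
  have e4 : xi hr ρ' = γ⁻¹ * d * γ * xi hr ρ * (b⁻¹ * q * b') := by
    rw [← inv_mul_cancel_left γ (xi hr ρ'), e3]
    group
  -- All other factors in `e4` lie in `P_{n,r}`, so this one does too, and its image under `ω` lies
  -- in the boundary group.
  have hu : γ⁻¹ * d * γ ∈ parabolic ℚ hr := by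
    have : γ⁻¹ * d * γ = xi hr ρ' * (b⁻¹ * q * b')⁻¹ * (xi hr ρ)⁻¹ := by
      rw [e4]
      group
    rw [this]
    exact mul_mem (mul_mem (xi_mem _ _) (inv_mem hx)) (inv_mem (xi_mem _ _))
  have e5 : ρ' = omega ℚ hr ⟨_, hu⟩ * ρ * omega ℚ hr ⟨_, hx⟩ := by
    rw [← omega_xi hr ρ', ← omega_xi hr ρ, ← map_mul, ← map_mul]
    congr 1
    exact Subtype.ext e4
  have hbd : omega ℚ hr ⟨_, hu⟩ ∈ boundaryGroup hr (Gamma0 n N) γ := by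
    refine ⟨⟨_, hu⟩, ?_, rfl⟩
    change γ * (γ⁻¹ * d * γ) * γ⁻¹ ∈ Gamma0 n N
    rwa [show γ * (γ⁻¹ * d * γ) * γ⁻¹ = d by group]
  rw [e5, cusp_mul hs _ hbd (omega_mem_parabolic hs hr _ hx')]

/-! ### The cusps containing a given cusp -/

section Shift

variable {N s : ℕ} {l : Fin (n - s) → ℕ} {c : Fin (n - (s + 1)) → ℕ}

theorem IsCuspTuple.eq_of_prime_dvd {k : ℕ} {l : Fin k → ℕ} (hl : IsCuspTuple N l) {p : ℕ}
    (hp : p.Prime) {i j : Fin k} (hi : p ∣ l i) (hj : p ∣ l j) : i = j := by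
  by_contra h
  exact hp.one_lt.ne' (Nat.dvd_one.1 ((hl.2 h) ▸ Nat.dvd_gcd hi hj))

theorem val_lt_sub {n s : ℕ} (i : Fin (n - (s + 1))) : (i : ℕ) < n - s := by
  omega

/-- Squarefreeness makes `p ∣ x / e` equivalent to `p ∣ x` and `¬ p ∣ e`. At the top index nothing
is divided out and the condition on `c` is empty. -/
theorem shiftTuple_spec (hN : Squarefree N) (hl : IsCuspTuple N l)
    (hc : ∀ i, c i ∣ l ⟨i, val_lt_sub i⟩) (i : Fin (n - (s + 1))) :
    shiftTuple l c i ∣ N ∧ ∀ p : ℕ, p.Prime → (p ∣ shiftTuple l c i ↔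
      (p ∣ l ⟨i + 1, by omega⟩ ∧ ∀ h : (i : ℕ) + 1 < n - (s + 1), ¬ p ∣ c ⟨i + 1, h⟩) ∨ p ∣ c i) := by
  rw [shiftTuple]
  set e := (if h : (i : ℕ) + 1 < n - (s + 1) then c ⟨i + 1, h⟩ else 1) with he
  set x := l ⟨i + 1, by omega⟩ with hx
  have hex : e ∣ x := by
    rw [he]
    split_ifs with h
    · exact hc ⟨i + 1, h⟩
    · exact one_dvd _
  obtain ⟨m, hm⟩ := hex
  have hx0 : 0 < x := (hl.1 _).1
  have he0 : 0 < e := Nat.pos_of_ne_zero fun h => by rw [h, zero_mul] at hm; omega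
  have hsq : Squarefree (e * m) := hm ▸ hN.squarefree_of_dvd (hl.1 _).2
  have hdiv : x / e = m := by rw [hm, Nat.mul_div_cancel_left _ he0]
  rw [hdiv]
  have hmx : m ∣ x := hm ▸ dvd_mul_left _ _
  constructor
  · refine Nat.Coprime.mul_dvd_of_dvd_of_dvd ?_ (hmx.trans (hl.1 _).2) ((hc i).trans (hl.1 _).2)
    refine Nat.Coprime.of_dvd hmx (hc i) (hl.2 ?_)
    rw [Ne, Fin.ext_iff]
    simp
  · intro p hp
    rw [hp.dvd_mul]
    refine or_congr_left ?_
    have he' : p ∣ e ↔ ∃ h : (i : ℕ) + 1 < n - (s + 1), p ∣ c ⟨i + 1, h⟩ := by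
      rw [he]
      split_ifs with h
      · exact ⟨fun h' => ⟨h, h'⟩, fun ⟨_, h'⟩ => h'⟩
      · exact ⟨fun h' => absurd (Nat.dvd_one.1 h') hp.one_lt.ne', fun ⟨h', _⟩ => absurd h' h⟩
    rw [← not_exists, ← he']
    constructor
    · intro h
      refine ⟨h.trans hmx, fun h' => ?_⟩
      exact hp.one_lt.ne' (Nat.isUnit_iff.1 (hsq p (mul_dvd_mul h' h)))
    · rintro ⟨h1, h2⟩
      rw [hm] at h1
      exact (hp.dvd_mul.1 h1).resolve_left h2

/-- A prime divides at most one `l k`; it then stays at `k` if it divides `c k` and moves to `k - 1`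
otherwise, never both. -/
theorem shiftTuple_isCuspTuple (hN : Squarefree N) (hl : IsCuspTuple N l)
    (hc : ∀ i, c i ∣ l ⟨i, val_lt_sub i⟩) : IsCuspTuple N (shiftTuple l c) := by
  refine ⟨fun i => ⟨Nat.pos_of_dvd_of_pos (shiftTuple_spec hN hl hc i).1
    (Nat.pos_of_ne_zero hN.ne_zero), (shiftTuple_spec hN hl hc i).1⟩, fun i j hij => ?_⟩
  refine Nat.Coprime.symm (Nat.coprime_of_dvd fun p hp h1 h2 => hij (Fin.ext ?_))
  have key : ∀ i, p ∣ c i → p ∣ l ⟨i, by omega⟩ := fun i h => h.trans (hc i)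
  rcases ((shiftTuple_spec hN hl hc _).2 p hp).1 h1 with ⟨a1, a2⟩ | a <;>
    rcases ((shiftTuple_spec hN hl hc _).2 p hp).1 h2 with ⟨b1, b2⟩ | b
  · have := congrArg Fin.val (hl.eq_of_prime_dvd hp a1 b1)
    simp only at this
    omega
  · have := congrArg Fin.val (hl.eq_of_prime_dvd hp a1 (key _ b))
    simp only at this
    refine absurd ?_ (a2 (by omega))
    convert b
  · have := congrArg Fin.val (hl.eq_of_prime_dvd hp (key _ a) b1)
    simp only at this
    refine absurd ?_ (b2 (by omega))
    convert a
    exact this.symm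
  · have := congrArg Fin.val (hl.eq_of_prime_dvd hp (key _ a) (key _ b))
    simp only at this
    omega

theorem eq_shiftTuple {N : ℕ} (hN : Squarefree N) (g : ∀ m : ℕ, ℕ → Sp m ℤ)
    (hg : ∀ m l : ℕ, 1 ≤ m → m ≤ n → l ∣ N → IsBasicRep m N l (g m l)) (hs : s + 1 ≤ n)
    (hl : IsCuspTuple N l) {d : Fin (n - (s + 1)) → ℕ} (hd : IsCuspTuple N d)
    (h : cusp (Nat.le_of_succ_le hs) (Gamma0 n N) (cuspRep g l) ⊆
      cusp hs (Gamma0 n N) (cuspRep g d)) :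
    ∃ c : Fin (n - (s + 1)) → ℕ, (∀ i, c i ∣ l ⟨i, val_lt_sub i⟩) ∧ d = shiftTuple l c := by
  -- The primes whose rank does not drop.
  let c : Fin (n - (s + 1)) → ℕ := fun i => Nat.gcd (l ⟨i, by omega⟩) (d i)
  have hc : ∀ i, c i ∣ l ⟨i, val_lt_sub i⟩ := fun i => Nat.gcd_dvd_left _ _
  refine ⟨c, hc, funext fun i => ?_⟩
  obtain ⟨h1, h2⟩ := shiftTuple_spec hN hl hc i
  refine eq_of_forall_prime_dvd_iff hN.ne_zero (hN.squarefree_of_dvd (hd.1 i).2)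
    (hN.squarefree_of_dvd h1) (hd.1 i).2 h1 fun p hp => ?_
  rw [h2 p (Nat.prime_of_mem_primeFactors hp)]
  rw [← map_intCuspRep, ← map_intCuspRep] at h
  have hr := rankAt_of_cusp_subset hN _ _ (Nat.le_add_right s 1) h hp
  -- At the top index there is no next `c`; this bound excludes that the rank stays.
  have hle := rankAt_le p (intCuspRep g d) (s + 1)
  simp only [c, Nat.dvd_gcd_iff, dvd_iff_rankAt g hg hl hp, dvd_iff_rankAt g hg hd hp]
  have hi := i.2
  constructor
  · intro e
    by_cases e' : rankAt p (intCuspRep g l) s = i + 1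
    · exact Or.inr ⟨e', e⟩
    · exact Or.inl ⟨by omega, fun _ h => by omega⟩
  · rintro (⟨e, e'⟩ | ⟨-, e⟩)
    · by_cases hi' : (i : ℕ) + 1 < n - (s + 1)
      · have := e' hi'
        omega
      · omega
    · exact e

/-- One integral matrix `a` realizes the ranks of both cusps, and the `s`-cusp of `a` lies in its
`(s+1)`-cusp. -/
theorem cusp_subset_shiftTuple {N : ℕ} (hN : Squarefree N) (g : ∀ m : ℕ, ℕ → Sp m ℤ)
    (hg : ∀ m l : ℕ, 1 ≤ m → m ≤ n → l ∣ N → IsBasicRep m N l (g m l)) (hs : s + 1 < n)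
    (hl : IsCuspTuple N l) (hc : ∀ i, c i ∣ l ⟨i, val_lt_sub i⟩) :
    cusp (Nat.le_of_succ_le hs.le) (Gamma0 n N) (cuspRep g l) ⊆
      cusp hs.le (Gamma0 n N) (cuspRep g (shiftTuple l c)) := by
  have hd := shiftTuple_isCuspTuple hN hl hc
  let x : ℕ → ℕ := fun p => rankAt p (intCuspRep g l) s
  let y : ℕ → ℕ := fun p => rankAt p (intCuspRep g (shiftTuple l c)) (s + 1)
  have hx : ∀ p, x p ≤ n - s := fun p => rankAt_le _ _ _
  have hy : ∀ p, y p ≤ n - (s + 1) := fun p => rankAt_le _ _ _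
  have hxy : ∀ p ∈ N.primeFactors, y p = x p ∨ y p + 1 = x p := by
    intro p hp
    have hl' := dvd_iff_rankAt g hg hl hp
    have hd' := dvd_iff_rankAt g hg hd hp
    have hpp := Nat.prime_of_mem_primeFactors hp
    have key : ∀ i, p ∣ c i → x p = i + 1 := fun i h => (hl' ⟨i, by omega⟩).1 (h.trans (hc i))
    have key' : ∀ i : Fin (n - (s + 1)), y p = i + 1 → x p = i + 2 ∨ x p = i + 1 := by
      intro i hi
      rcases ((shiftTuple_spec hN hl hc i).2 p hpp).1 ((hd' i).2 hi) with ⟨h, -⟩ | h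
      · exact Or.inl ((hl' _).1 h)
      · exact Or.inr (key i h)
    rcases Nat.eq_zero_or_pos (y p) with hy0 | hy0
    · by_contra hcon
      have hx2 : 2 ≤ x p := by omega
      have := hx p
      -- A prime in `l` at position `x p - 1 ≥ 1` survives in the shifted tuple, at that position or
      -- one below, so `y p` could not be `0`.
      let i : Fin (n - (s + 1)) := ⟨x p - 2, by omega⟩
      have hli : p ∣ l ⟨i + 1, by omega⟩ := (hl' _).2 (by change x p = x p - 2 + 1 + 1; omega)
      have hyi : ∀ j : Fin (n - (s + 1)), ¬ p ∣ shiftTuple l c j := fun j h => by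
        have : y p = j + 1 := (hd' j).1 h
        omega
      by_cases hex : ∃ h : (i : ℕ) + 1 < n - (s + 1), p ∣ c ⟨i + 1, h⟩
      · obtain ⟨h, hci⟩ := hex
        exact hyi _ (((shiftTuple_spec hN hl hc _).2 p hpp).2 (Or.inr hci))
      · exact hyi _ (((shiftTuple_spec hN hl hc i).2 p hpp).2
          (Or.inl ⟨hli, not_exists.1 hex⟩))
    · have := hy p
      rcases key' ⟨y p - 1, by omega⟩ (by simp only; omega) with h | h <;>
      · simp only at h
        omega
  -- A segment of length `x p` starting at `s + 1` has equal ranks at `s` and `s + 1`; starting at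
  -- `s`, the rank drops by one.
  obtain ⟨a, ha⟩ := exists_red_eq_weyl (N := N) fun p =>
    if y p = x p then seg n (s + 1) (s + 1 + x p) else seg n s (s + x p)
  have h1 : ∀ p ∈ N.primeFactors, rankAt p (intCuspRep g l) s = rankAt p a s := by
    intro p hp
    rw [rankAt_of_red_eq_weyl (Nat.prime_of_mem_primeFactors hp) (ha p hp)]
    have := hx p
    have := hy p
    change x p = _
    split_ifs with h
    · rw [card_seg_inter_tail (by omega)]
      omega
    · rw [card_seg_inter_tail (by omega)]
      omega
  have h2 : ∀ p ∈ N.primeFactors, rankAt p a (s + 1) =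
      rankAt p (intCuspRep g (shiftTuple l c)) (s + 1) := by
    intro p hp
    rw [rankAt_of_red_eq_weyl (Nat.prime_of_mem_primeFactors hp) (ha p hp)]
    have := hx p
    have := hy p
    have := hxy p hp
    change _ = y p
    split_ifs with h
    · rw [card_seg_inter_tail (by omega)]
      omega
    · rw [card_seg_inter_tail (by omega)]
      omega
  rw [← map_intCuspRep, ← map_intCuspRep, cusp_eq_of_rankAt_eq hN _ _ _ h1,
    ← cusp_eq_of_rankAt_eq hN _ _ _ h2]
  exact cusp_subset_cusp (Nat.le_add_right s 1) hs.le _ _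

end Shift

end Main

end SiegelCusps

theorem mainTheorem3 (n N : ℕ) (hn : 0 < n) (hN : Squarefree N)
    (g : ∀ m : ℕ, ℕ → SiegelCusps.Sp m ℤ)
    (hg : ∀ m l : ℕ, 1 ≤ m → m ≤ n → l ∣ N → SiegelCusps.IsBasicRep m N l (g m l)) :
    -- the `r`-cusps correspond to the tuples
    (∀ (r : ℕ) (hr : r ≤ n),
      Set.BijOn
        (fun l : Fin (n - r) → ℕ =>
          SiegelCusps.cusp hr (SiegelCusps.Gamma0 n N) (SiegelCusps.cuspRep g l))
        {l | SiegelCusps.IsCuspTuple N l}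
        (SiegelCusps.cusps hr (SiegelCusps.Gamma0 n N))) ∧
    -- no `r`-cusp intersects itself at an `s`-cusp
    (∀ (r s : ℕ) (hr : r ≤ n) (hs : s ≤ r) (l : Fin (n - r) → ℕ), SiegelCusps.IsCuspTuple N l →
      ∀ S ∈ SiegelCusps.cusps hs
          (SiegelCusps.boundaryGroup hr (SiegelCusps.Gamma0 n N) (SiegelCusps.cuspRep g l)),
      ∀ S' ∈ SiegelCusps.cusps hs
          (SiegelCusps.boundaryGroup hr (SiegelCusps.Gamma0 n N) (SiegelCusps.cuspRep g l)),
        SiegelCusps.boundaryMap hr (SiegelCusps.Gamma0 n N) (SiegelCusps.cuspRep g l) '' S =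
          SiegelCusps.boundaryMap hr (SiegelCusps.Gamma0 n N) (SiegelCusps.cuspRep g l) '' S' →
        S = S') ∧
    -- the `(s + 1)`-cusps containing a given `s`-cusp
    (∀ (s : ℕ) (hs : s + 1 < n) (l : Fin (n - s) → ℕ), SiegelCusps.IsCuspTuple N l →
      ∀ d : Fin (n - (s + 1)) → ℕ,
        (SiegelCusps.IsCuspTuple N d ∧
          SiegelCusps.cusp (Nat.le_of_succ_le hs.le) (SiegelCusps.Gamma0 n N)
              (SiegelCusps.cuspRep g l) ⊆
            SiegelCusps.cusp hs.le (SiegelCusps.Gamma0 n N) (SiegelCusps.cuspRep g d)) ↔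
        ∃ c : Fin (n - (s + 1)) → ℕ, (∀ i, c i ∣ l ⟨i, by omega⟩) ∧
          d = SiegelCusps.shiftTuple l c) := by
  refine ⟨fun r hr => ⟨fun l _ => ⟨_, rfl⟩, fun l hl l' hl' h =>
      SiegelCusps.cuspTuple_injective hN g hg hr hl hl' h, ?_⟩, ?_, ?_⟩
  · rintro _ ⟨γ, rfl⟩
    obtain ⟨l, hl, h⟩ := SiegelCusps.exists_cuspTuple hN g hg hr γ
    exact ⟨l, hl, h⟩
  · rintro r s hr hs l - _ ⟨ρ, rfl⟩ _ ⟨ρ', rfl⟩ h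
    rw [SiegelCusps.image_boundaryMap_cusp, SiegelCusps.image_boundaryMap_cusp] at h
    exact SiegelCusps.cusp_eq_of_image_eq hN hs hr _ ρ ρ' h
  · intro s hs l hl d
    constructor
    · rintro ⟨hd, h⟩
      exact SiegelCusps.eq_shiftTuple hN g hg hs.le hl hd h
    · rintro ⟨c, hc, rfl⟩
      exact ⟨SiegelCusps.shiftTuple_isCuspTuple hN hl hc,
        SiegelCusps.cusp_subset_shiftTuple hN g hg hs hl hc⟩
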